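/- Let $M$ be a smooth 3-manifold with a contact structure $\xi$ (a plane field that is locally the kernel of a smooth 1-form $\alpha$ with $\alpha\wedge d\alpha\neq 0$). Let $Y$ be a smooth vector field on $M$, transverse to $\xi$, whose flow preserves $\xi$ (a Reeb field of $\xi$). Suppose that $Y$ is contact integrable: there is a foliation $\mathcal G$ of $M$ by curves with $T\mathcal G\subset\xi$ that is preserved by the flow of $Y$. Suppose moreover that the associated co-Legendrian foliation is given by $T\mathcal G\oplus\langle Y\rangle=\ker\gamma$ for a smooth closed 1-form $\gamma$ on $M$. Then there is a smooth contact form $\alpha$ on $M$ with $\ker\alpha=\xi$, $i_Y\alpha\equiv1$ and $i_Yd\alpha\equiv0$ (the contact form for $\xi$ having $Y$ as its Reeb field), and $\tilde\xi:=\ker(\alpha+\gamma)$ has the following properties. (1) $\tilde\xi$ is a contact structure on $M$ transverse to $\xi$ (i.e. $\xi+\tilde\xi=TM$), and $\xi,\tilde\xi$ are commonly oriented: for local contact forms $\beta,\tilde\beta$ of $\xi,\tilde\xi$, the volume forms $\beta\wedge d\beta$ and $\tilde\beta\wedge d\tilde\beta$ are positive multiples of one another. (2) The flow of $Y$ preserves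 $\tilde\xi$. (3) For a suitable orientation of the axis $\xi\cap\tilde\xi$, the generating invariant of the pair is $I\equiv2$. Here, for a commonly oriented transverse pair with oriented axis, one chooses locally contact forms $\beta,\tilde\beta$ of $\xi,\tilde\xi$ with $\beta\wedge d\beta=\tilde\beta\wedge d\tilde\beta$ such that the vector field $X$ along the axis defined by $i_X(\beta\wedge d\beta)=\beta\wedge\tilde\beta$ is positively oriented, and $I$ is the function with $\beta\wedge d\tilde\beta+\tilde\beta\wedge d\beta=I\,\beta\wedge d\beta$. It does not depend on the choice, and changes sign with the orientation of the axis. (4) Around every point of $M$ the pair is locally of type I$_2$ with $c=2$: there are smooth local coordinates $(x,y,p)$ centred at the point in which $$\xi=\{dy=p\,dx\},\qquad \tilde\xi=\{(p+2)\,dy+dx=0\}.$$ -/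

import Mathlib

open scoped Manifold ContDiff Topology
open Bundle

noncomputable section

namespace ContactPair

/-- The model space `ℝ³`; 3-manifolds are smooth manifolds (without boundary) modelled on it. -/
abbrev R3 : Type := EuclideanSpace ℝ (Fin 3)

section Definitions

variable (M : Type*) [TopologicalSpace M] [ChartedSpace R3 M] [IsManifold (𝓡 3) ∞ M]

/-- A (not necessarily continuous) vector field. -/
abbrev VField : Type _ := (q : M) → TangentSpace (𝓡 3) q

/-- A (not necessarily continuous) 1-form. -/
abbrev OneForm : Type _ := (q : M) → (TangentSpace (𝓡 3) q →L[ℝ] ℝ)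

/-- A (not necessarily continuous) field of linear subspaces of the tangent spaces. -/
abbrev Distribution : Type _ := (q : M) → Submodule ℝ (TangentSpace (𝓡 3) q)

variable {M}

/-- Smoothness of a vector field on a subset, as a section of the tangent bundle. -/
def SmoothVFieldOn (Z : VField M) (U : Set M) : Prop :=
  ContMDiffOn (𝓡 3) (𝓡 3).tangent ∞ (fun q => (⟨q, Z q⟩ : TangentBundle (𝓡 3) M)) U

/-- Smoothness of a 1-form on a subset, as a section of the cotangent bundle. -/
def SmoothOneFormOn (α : OneForm M) (U : Set M) : Prop :=
  ContMDiffOn (𝓡 3) ((𝓡 3).prod 𝓘(ℝ, R3 →L[ℝ] ℝ)) ∞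
    (fun q => TotalSpace.mk' (R3 →L[ℝ] ℝ)
      (E := fun q : M => (TangentSpace (𝓡 3) q →L[ℝ] ℝ)) q (α q)) U

/-- The kernel of a 1-form, as a field of subspaces. -/
def kerField (α : OneForm M) : Distribution M := fun q => LinearMap.ker (α q).toLinearMap

/-- The 1-form `α` read in the preferred chart `φ` at `m`: the pull-back `(φ⁻¹)^* α`. -/
def inChart (α : OneForm M) (m : M) : R3 → (R3 →L[ℝ] ℝ) :=
  letI : ChartedSpace R3 R3 := chartedSpaceSelf R3
  fun y => (α ((extChartAt (𝓡 3) m).symm y)).comp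
      (mfderiv 𝓘(ℝ, R3) (𝓡 3) (extChartAt (𝓡 3) m).symm y)

/-- The exterior derivative `dα` of a 1-form at `m`, computed in the preferred chart at `m`
(in which `T_m M` is identified with `ℝ³`): `dα(v, w) = D_v a (w) - D_w a (v)`. -/
def extD (α : OneForm M) (m : M) (v w : TangentSpace (𝓡 3) m) : ℝ :=
  let D : R3 →L[ℝ] R3 →L[ℝ] ℝ := fderiv ℝ (inChart α m) (extChartAt (𝓡 3) m m)
  D v w - D w v

/-- `(α ∧ β)(u, v)` for 1-forms `α`, `β`. -/
def wedge (α β : OneForm M) (q : M) (u v : TangentSpace (𝓡 3) q) : ℝ :=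
  α q u * β q v - α q v * β q u

/-- The 3-form `(α ∧ dβ)(u, v, w)` for 1-forms `α`, `β`. -/
def wedgeD (α β : OneForm M) (q : M) (u v w : TangentSpace (𝓡 3) q) : ℝ :=
  α q u * extD β q v w + α q v * extD β q w u + α q w * extD β q u v

/-- `α` is a smooth contact form for `ξ` over the open set `U`: `ξ = ker α` and `α ∧ dα`
vanishes nowhere on `U`. -/
structure IsContactFormOn (ξ : Distribution M) (α : OneForm M) (U : Set M) : Prop where
  isOpen : IsOpen U
  smooth : SmoothOneFormOn α U
  ker_eq : ∀ q ∈ U, kerField α q = ξ q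
  nondegenerate : ∀ q ∈ U, ∃ u v w : TangentSpace (𝓡 3) q, wedgeD α α q u v w ≠ 0

/-- A contact structure on a 3-manifold: locally the kernel of a smooth contact form. -/
def IsContactStructure (ξ : Distribution M) : Prop :=
  ∀ m : M, ∃ U : Set M, m ∈ U ∧ ∃ α : OneForm M, IsContactFormOn ξ α U

/-- Two distributions are transverse if they span the tangent space at each point. -/
def Transverse (ξ ξ' : Distribution M) : Prop := ∀ q, ξ q ⊔ ξ' q = ⊤

/-- The orientations induced by the contact structures `ξ`, `ξ'` coincide: for all local contact
forms, `α ∧ dα` is at each point a positive multiple of `α' ∧ dα'`. -/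
def CommonlyOriented (ξ ξ' : Distribution M) : Prop :=
  ∀ (U : Set M) (α α' : OneForm M), IsContactFormOn ξ α U → IsContactFormOn ξ' α' U →
    ∀ q ∈ U, ∃ r : ℝ, 0 < r ∧ ∀ u v w : TangentSpace (𝓡 3) q,
      wedgeD α α q u v w = r * wedgeD α' α' q u v w

/-- `Φ` is a smooth local flow of `Y`, defined on the open set `U` for times in `(-ε, ε)`. -/
structure IsLocalFlow (Y : VField M) (U : Set M) (ε : ℝ) (Φ : ℝ → M → M) : Prop where
  isOpen : IsOpen U
  pos : 0 < ε
  smooth : ContMDiffOn (𝓘(ℝ, ℝ).prod (𝓡 3)) (𝓡 3) ∞ (fun z : ℝ × M => Φ z.1 z.2)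
    (Set.Ioo (-ε) ε ×ˢ U)
  zero : ∀ q ∈ U, Φ 0 q = q
  integralCurve : ∀ q ∈ U, IsMIntegralCurveOn (fun t => Φ t q) Y (Set.Ioo (-ε) ε)

/-- The flow of `Y` preserves the distribution `D`: `Y` has a local flow around each point, and
each of its local flows satisfies `(Φ_t)_* D = D`. -/
def FlowPreserves (Y : VField M) (D : Distribution M) : Prop :=
  (∀ m : M, ∃ U ε Φ, m ∈ U ∧ IsLocalFlow Y U ε Φ) ∧
  ∀ U ε Φ, IsLocalFlow Y U ε Φ → ∀ t ∈ Set.Ioo (-ε) ε, ∀ q ∈ U,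
    (D q).map (mfderiv (𝓡 3) (𝓡 3) (Φ t) q).toLinearMap = D (Φ t q)

/-- A Reeb field of `ξ`: a smooth vector field transverse to `ξ` whose flow preserves `ξ`. -/
structure IsReebField (ξ : Distribution M) (Y : VField M) : Prop where
  smooth : SmoothVFieldOn Y Set.univ
  transverse : ∀ q, Y q ∉ ξ q
  preserves : FlowPreserves Y ξ

/-- A foliation by curves, given by its tangent line field `L`: a smooth field of lines. -/
def IsLineField (L : Distribution M) : Prop :=
  ∀ m : M, ∃ U : Set M, IsOpen U ∧ m ∈ U ∧ ∃ Z : VField M, SmoothVFieldOn Z U ∧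
    ∀ q ∈ U, Z q ≠ 0 ∧ L q = Submodule.span ℝ {Z q}

/-- `Y` is a contact integrable Reeb field of `ξ`, as witnessed by the Legendrian foliation with
tangent line field `L`, which is preserved by (the flow of) `Y`. -/
structure IsContactIntegrable (ξ : Distribution M) (Y : VField M) (L : Distribution M) :
    Prop where
  reeb : IsReebField ξ Y
  lineField : IsLineField L
  legendrian : ∀ q, L q ≤ ξ q
  preserves : FlowPreserves Y L

/-- A smooth closed 1-form on `M`. -/
structure IsClosedForm (γ : OneForm M) : Prop where
  smooth : SmoothOneFormOn γ Set.univ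
  closed : ∀ (q : M) (v w : TangentSpace (𝓡 3) q), extD γ q v w = 0

/-- For a commonly oriented transverse pair `ξ`, `ξ'`: `X` is the normalized vector field along the
axis `ξ ∩ ξ'` (for the orientation of the axis that it defines), and `I` is the generating
invariant. Around each point there are balanced contact forms `α`, `α'`, i.e.
`α ∧ dα = α' ∧ dα'`, with `i_X (α ∧ dα) = α ∧ α'` and
`α ∧ dα' + α' ∧ dα = I α ∧ dα`. (Such `α`, `α'` are unique up to a common factor, so that `I` is
determined by the orientation of the axis, and reversing the latter changes its sign.) -/
def IsGeneratingInvariant (ξ ξ' : Distribution M) (X : VField M) (I : M → ℝ) : Prop :=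
  ∀ m : M, ∃ (U : Set M) (α α' : OneForm M), m ∈ U ∧
    IsContactFormOn ξ α U ∧ IsContactFormOn ξ' α' U ∧
    ∀ q ∈ U, X q ∈ ξ q ⊓ ξ' q ∧
      (∀ u v w, wedgeD α α q u v w = wedgeD α' α' q u v w) ∧
      (∀ v w, wedgeD α α q (X q) v w = wedge α α' q v w) ∧
      (∀ u v w, wedgeD α α' q u v w + wedgeD α' α q u v w = I q * wedgeD α α q u v w)

/-- The pair `ξ`, `ξ'` is around `m` of type I₂ with constant `c`: there are smooth coordinates
`φ = (x, y, p)` centred at `m` in which `ξ = {dy = p dx}` and `ξ' = {(p + c) dy + dx = 0}`. -/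
def IsTypeI2At (ξ ξ' : Distribution M) (c : ℝ) (m : M) : Prop :=
  letI : ChartedSpace ℝ ℝ := chartedSpaceSelf ℝ
  ∃ φ ∈ IsManifold.maximalAtlas (𝓡 3) ∞ M, m ∈ φ.source ∧ φ m = 0 ∧
    ∀ q ∈ φ.source, ∀ v : TangentSpace (𝓡 3) q,
      let p : ℝ := φ q 2
      let dx : ℝ := mfderiv (𝓡 3) 𝓘(ℝ, ℝ) (fun q => φ q 0) q v
      let dy : ℝ := mfderiv (𝓡 3) 𝓘(ℝ, ℝ) (fun q => φ q 1) q v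
      (v ∈ ξ q ↔ dy = p * dx) ∧ (v ∈ ξ' q ↔ (p + c) * dy + dx = 0)

end Definitions

end ContactPair

end

/-! Everything follows from a local normal form. Scale a contact form so that `α(Y) = 1`. The flow
of `Y` preserves `ker α` and `Y`, hence `α` itself (`IsLocalFlow.pullback_of_preserves`), and
therefore `i_Y dα = 0` (`eventually_dForm_field_eq_zero`). The plane `ker γ` contains `Y`, so `dα`
vanishes on it (`dForm_eq_zero_of_mem_ker`). Locally `γ = dF`, so `α` is closed along the level sets
of `F`, and a Poincaré lemma with parameter gives `α = dt + p dF` (`exists_leafwise_normal_form`).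

Now `dα = dp ∧ dF`, and contactness says that `dt`, `dp`, `dF` are independent. With `α' = α + γ =
dt + (p + 1) dF` one has `dα' = dα` and `γ ∧ dα = 0`. Hence `α ∧ dα`, `α' ∧ dα'`, `α ∧ dα'` and `α'
∧ dα` all coincide: the forms are already balanced, the orientations agree, and `I = 1 + 1 = 2`. The
flow preserves `γ`, which is closed and kills `Y` (`IsLocalFlow.pullback_closed`), so it preserves
`α'` too.

For type I₂, shift `p` by a constant so that it is `1` at the base point, and take `(x, y, P) = (-t,
t + F, 1/p - 1)`. Then `dy - P dx = α/p` and `(P + 2) dy + dx = α'/p` (`exists_typeI2_coordinates`).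
-/

noncomputable section

namespace ContactPair

/-! ### Exterior derivatives on normed spaces and smooth parametric integrals. -/

section Calculus

open MeasureTheory Filter

/-- The exterior derivative of a 1-form on a normed space. -/
def dForm {E : Type*} [NormedAddCommGroup E] [NormedSpace ℝ E] (a : E → E →L[ℝ] ℝ) (x v w : E) :
    ℝ :=
  fderiv ℝ a x v w - fderiv ℝ a x w v

variable {E F : Type*} [NormedAddCommGroup E] [NormedSpace ℝ E] [NormedAddCommGroup F]
  [NormedSpace ℝ F]

theorem dForm_congr {a b : E → E →L[ℝ] ℝ} {x : E} (h : a =ᶠ[𝓝 x] b) (v w : E) :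
    dForm a x v w = dForm b x v w := by
  simp only [dForm, h.fderiv_eq]

theorem dForm_self (a : E → E →L[ℝ] ℝ) (x v : E) : dForm a x v v = 0 := by simp [dForm]

theorem dForm_swap (a : E → E →L[ℝ] ℝ) (x v w : E) : dForm a x v w = -dForm a x w v := by
  simp [dForm]

theorem dForm_add_left (a : E → E →L[ℝ] ℝ) (x u v w : E) :
    dForm a x (u + v) w = dForm a x u w + dForm a x v w := by
  simp only [dForm, map_add, add_apply]; ring

theorem dForm_smul_left (a : E → E →L[ℝ] ℝ) (x : E) (c : ℝ) (v w : E) :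
    dForm a x (c • v) w = c * dForm a x v w := by
  simp only [dForm, map_smul, smul_apply, smul_eq_mul]; ring

theorem dForm_const (a : E →L[ℝ] ℝ) (x v w : E) : dForm (fun _ => a) x v w = 0 := by
  simp [dForm]

theorem dForm_add {a b : E → E →L[ℝ] ℝ} {x : E} (ha : DifferentiableAt ℝ a x)
    (hb : DifferentiableAt ℝ b x) (v w : E) :
    dForm (fun y => a y + b y) x v w = dForm a x v w + dForm b x v w := by
  simp only [dForm, fderiv_fun_add ha hb, add_apply]; ring

theorem dForm_smul {f : E → ℝ} {a : E → E →L[ℝ] ℝ} {x : E} (hf : DifferentiableAt ℝ f x)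
    (ha : DifferentiableAt ℝ a x) (v w : E) :
    dForm (fun y => f y • a y) x v w =
      f x * dForm a x v w + (fderiv ℝ f x v * a x w - fderiv ℝ f x w * a x v) := by
  simp only [dForm, fderiv_fun_smul hf ha, add_apply,
    smul_apply, ContinuousLinearMap.smulRight_apply, smul_eq_mul]
  ring

theorem dForm_fderiv {f : E → ℝ} {x : E} (hf : ContDiffAt ℝ 2 f x) (v w : E) :
    dForm (fun y => fderiv ℝ f y) x v w = 0 :=
  sub_eq_zero.2 (hf.isSymmSndFDerivAt (by simp) v w)

/-- The exterior derivative commutes with pull-back. -/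
theorem dForm_pullback {a : F → F →L[ℝ] ℝ} {f : E → F} {x : E}
    (ha : DifferentiableAt ℝ a (f x)) (hf : ContDiffAt ℝ 2 f x) (v w : E) :
    dForm (fun y => (a (f y)).comp (fderiv ℝ f y)) x v w =
      dForm a (f x) (fderiv ℝ f x v) (fderiv ℝ f x w) := by
  have h1 : DifferentiableAt ℝ f x := hf.differentiableAt (by simp)
  have h2 : DifferentiableAt ℝ (fderiv ℝ f) x :=
    (hf.fderiv_right (m := 1) (by norm_num)).differentiableAt (by simp)
  have h3 : HasFDerivAt (fun y => a (f y)) ((fderiv ℝ a (f x)).comp (fderiv ℝ f x)) x :=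
    ha.hasFDerivAt.comp x h1.hasFDerivAt
  have h4 := hf.isSymmSndFDerivAt (by simp) v w
  simp only [dForm, (h3.clm_comp h2.hasFDerivAt).fderiv]
  simp [h4]

/-- Differentiation under the integral sign. The dominating constant bounds the partial derivative
on a closed ball times `[0, 1]`, which is compact because `H` is finite-dimensional. -/
theorem hasFDerivAt_parametric_intervalIntegral {H : Type*} [NormedAddCommGroup H]
    [NormedSpace ℝ H] [FiniteDimensional ℝ H] {G : Type*} [NormedAddCommGroup G] [NormedSpace ℝ G]
    {f : H × ℝ → G} (hf : ContDiff ℝ 1 f) (x : H) :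
    HasFDerivAt (fun x => ∫ t in (0 : ℝ)..1, f (x, t))
      (∫ t in (0 : ℝ)..1, (fderiv ℝ f (x, t)).comp (ContinuousLinearMap.inl ℝ H ℝ)) x := by
  have hc : Continuous f := hf.continuous
  have hf' : Continuous fun z => (fderiv ℝ f z).comp (ContinuousLinearMap.inl ℝ H ℝ) :=
    (hf.continuous_fderiv (by simp)).clm_comp continuous_const
  have : ProperSpace H := FiniteDimensional.proper_real H
  obtain ⟨C, hC⟩ := ((isCompact_closedBall x 1).prod
    (isCompact_Icc (a := (0 : ℝ)) (b := 1))).exists_bound_of_continuousOn hf'.continuousOn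
  refine intervalIntegral.hasFDerivAt_integral_of_dominated_of_fderiv_le
    (F := fun x t => f (x, t)) (bound := fun _ => C)
    (F' := fun x t => (fderiv ℝ f (x, t)).comp (ContinuousLinearMap.inl ℝ H ℝ))
    (Metric.closedBall_mem_nhds x one_pos) ?_ ?_ ?_ ?_ ?_ ?_
  · exact Eventually.of_forall fun y => (hc.comp (by fun_prop)).aestronglyMeasurable
  · exact (hc.comp (by fun_prop : Continuous fun t : ℝ => (x, t))).intervalIntegrable _ _
  · exact (hf'.comp (by fun_prop : Continuous fun t : ℝ => (x, t))).aestronglyMeasurable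
  · refine Eventually.of_forall fun t ht y hy => hC (y, t) ⟨hy, ?_⟩
    rw [Set.uIoc_of_le zero_le_one] at ht
    exact ⟨ht.1.le, ht.2⟩
  · exact intervalIntegrable_const
  · refine Eventually.of_forall fun t _ y _ => ?_
    have h1 : HasFDerivAt f (fderiv ℝ f (y, t)) (y, t) :=
      (hf.differentiable (by simp) _).hasFDerivAt
    exact h1.comp y (hasFDerivAt_prodMk_left y t)

/-- Parametric integrals of `C^n` functions are `C^n`. -/
theorem contDiff_parametric_intervalIntegral {H : Type} [NormedAddCommGroup H] [NormedSpace ℝ H]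
    [FiniteDimensional ℝ H] (n : ℕ) :
    ∀ {G : Type} [NormedAddCommGroup G] [NormedSpace ℝ G] {f : H × ℝ → G},
      ContDiff ℝ n f → ContDiff ℝ n (fun x => ∫ t in (0 : ℝ)..1, f (x, t)) := by
  induction n with
  | zero =>
    intro G _ _ f hf
    have hf' : Continuous f := hf.continuous
    simp only [CharP.cast_eq_zero, contDiff_zero]
    exact intervalIntegral.continuous_parametric_intervalIntegral_of_continuous' (by exact hf') 0 1
  | succ n ih =>
    intro G _ _ f hf
    have hn : ((n + 1 : ℕ) : ℕ∞ω) = n + 1 := by push_cast; rfl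
    rw [hn, contDiff_succ_iff_hasFDerivAt]
    -- The induction hypothesis is used for the partial derivative, whose values lie in `H →L[ℝ] G`;
    -- this is why `G` varies in the induction.
    refine ⟨fun x => ∫ t in (0 : ℝ)..1, (fderiv ℝ f (x, t)).comp (ContinuousLinearMap.inl ℝ H ℝ),
      ih (f := fun z => (fderiv ℝ f z).comp (ContinuousLinearMap.inl ℝ H ℝ))
        ((hf.fderiv_right (m := n) (by norm_cast)).clm_comp contDiff_const), fun x => ?_⟩
    exact hasFDerivAt_parametric_intervalIntegral (hf.of_le (by norm_cast; omega)) x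

end Calculus

/-! ### Poincaré lemmas and local normal forms in a vector space. -/

section NormalForm

open MeasureTheory Filter

/-- The inverse function theorem for `C^∞` maps, with a smooth inverse on the whole target. -/
theorem exists_smooth_openPartialHomeomorph {E F : Type*} [NormedAddCommGroup E] [NormedSpace ℝ E]
    [CompleteSpace E] [NormedAddCommGroup F] [NormedSpace ℝ F] {f : E → F} {x : E}
    (hf : ∀ᶠ z in 𝓝 x, ContDiffAt ℝ ∞ f z) (e' : E ≃L[ℝ] F) (he' : (e' : E →L[ℝ] F) = fderiv ℝ f x)
    {S : Set E} (hS : S ∈ 𝓝 x) :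
    ∃ e : OpenPartialHomeomorph E F, x ∈ e.source ∧ e.source ⊆ S ∧ (e : E → F) = f ∧
      ContDiffOn ℝ ∞ e e.source ∧ ContDiffOn ℝ ∞ e.symm e.target := by
  have hx := hf.self_of_nhds
  have hn : (∞ : ℕ∞ω) ≠ 0 := by simp
  have hd : HasFDerivAt f (e' : E →L[ℝ] F) x := by
    rw [he']; exact (hx.differentiableAt hn).hasFDerivAt
  let e₀ := hx.toOpenPartialHomeomorph f hd hn
  -- Invertibility of the derivative is an open condition; shrinking the source to where it holds
  -- makes the inverse smooth at every point of the target.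
  have hinv : ∀ᶠ z in 𝓝 x, fderiv ℝ f z ∈ Set.range ((↑) : (E ≃L[ℝ] F) → E →L[ℝ] F) := by
    have hc : ContinuousAt (fderiv ℝ f) x := hx.continuousAt_fderiv hn
    apply hc
    rw [← he']
    exact ContinuousLinearEquiv.nhds e'
  obtain ⟨O, hO, hOo, hxO⟩ := mem_nhds_iff.1 ((hf.and hinv).and hS)
  refine ⟨e₀.restrOpen O hOo, ⟨hx.mem_toOpenPartialHomeomorph_source hd hn, hxO⟩,
    fun z hz => (hO hz.2).2, rfl, fun z hz => (hO hz.2).1.1.contDiffWithinAt, fun w hw => ?_⟩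
  have hz := (e₀.restrOpen O hOo).map_target hw
  obtain ⟨⟨h1, ⟨e₁, he₁⟩⟩, -⟩ := hO hz.2
  refine ((e₀.restrOpen O hOo).contDiffAt_symm hw (f₀' := e₁) ?_ h1).contDiffWithinAt
  rw [he₁]
  exact (h1.differentiableAt hn).hasFDerivAt

/-- The function `f` is the integrand of the radial homotopy operator along a leaf. Its leaf
variable occurs both in the base point and in the argument, and the product rule on the line `s ↦ z
+ s (0, v)` yields one term for each. When `b` is closed along the leaf, the sum is the
`t`-derivative of `t * b (z.1, t • z.2) (0, v)`. -/
theorem fderiv_leafwise_integrand {G : Type*} [NormedAddCommGroup G] [NormedSpace ℝ G]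
    {b : ℝ × G → ℝ × G →L[ℝ] ℝ} (hb : ContDiff ℝ 1 b) {f : (ℝ × G) × ℝ → ℝ}
    (hf : f = fun q => b (q.1.1, q.2 • q.1.2) (0, q.1.2)) (hf1 : ContDiff ℝ 1 f)
    (z : ℝ × G) (t : ℝ) (v : G) :
    (fderiv ℝ f (z, t)).comp (ContinuousLinearMap.inl ℝ (ℝ × G) ℝ) (0, v) =
      t * fderiv ℝ b (z.1, t • z.2) (0, v) (0, z.2) + b (z.1, t • z.2) (0, v) := by
  have h4 : HasFDerivAt (fun x => f (x, t))
      ((fderiv ℝ f (z, t)).comp (ContinuousLinearMap.inl ℝ (ℝ × G) ℝ)) z :=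
    (hf1.differentiable (by simp) _).hasFDerivAt.comp z (hasFDerivAt_prodMk_left z t)
  have h1 : HasDerivAt (fun s : ℝ => z + s • ((0 : ℝ), v)) (0, v) 0 := by
    simpa using ((hasDerivAt_id (0 : ℝ)).smul_const ((0 : ℝ), v)).const_add z
  have h5 : HasDerivAt (fun s : ℝ => f (z + s • ((0 : ℝ), v), t))
      ((fderiv ℝ f (z, t)).comp (ContinuousLinearMap.inl ℝ (ℝ × G) ℝ) (0, v)) 0 :=
    HasFDerivAt.comp_hasDerivAt (l := fun x => f (x, t)) 0 (by simpa using h4) h1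
  have hB : HasFDerivAt b (fderiv ℝ b (z.1, t • z.2)) (z.1, t • z.2) :=
    (hb.differentiable (by simp) _).hasFDerivAt
  have h2 : HasDerivAt (fun s : ℝ => ((z.1, t • (z.2 + s • v)) : ℝ × G)) (0, t • v) 0 := by
    have : HasDerivAt (fun s : ℝ => t • (z.2 + s • v)) (t • v) 0 := by
      have := (((hasDerivAt_id (0 : ℝ)).smul_const v).const_add z.2).const_smul t
      rw [one_smul] at this
      exact this
    exact (hasDerivAt_const 0 z.1).prodMk this
  have h3 : HasDerivAt (fun s : ℝ => ((0, z.2 + s • v) : ℝ × G)) (0, v) 0 := by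
    have : HasDerivAt (fun s : ℝ => (z.2 + s • v)) v 0 := by
      simpa using (((hasDerivAt_id (0 : ℝ)).smul_const v).const_add z.2)
    exact (hasDerivAt_const 0 0).prodMk this
  have h6 : HasDerivAt (fun s : ℝ => b (z.1, t • (z.2 + s • v)))
      (fderiv ℝ b (z.1, t • z.2) (0, t • v)) 0 :=
    HasFDerivAt.comp_hasDerivAt (l := b) 0 (by simpa using hB) h2
  have h7 : HasDerivAt (fun s : ℝ => b (z.1, t • (z.2 + s • v)) (0, z.2 + s • v))
      (fderiv ℝ b (z.1, t • z.2) (0, t • v) (0, z.2) + b (z.1, t • z.2) (0, v)) 0 := by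
    simpa using h6.clm_apply h3
  have h8 : (fun s : ℝ => f (z + s • ((0 : ℝ), v), t)) =
      fun s : ℝ => b (z.1, t • (z.2 + s • v)) (0, z.2 + s • v) := by
    subst hf; funext s; simp
  rw [h8] at h5
  have h9 : ((0 : ℝ), t • v) = t • ((0 : ℝ), v) := by simp
  rw [h5.unique h7, h9, map_smul, smul_apply, smul_eq_mul]

/-- Leafwise Poincaré lemma: a 1-form on `ℝ × G` that is closed along the leaves `{u} × G` has
near `(u₀, 0)` a smooth leafwise primitive. -/
theorem exists_leafwise_primitive {G : Type} [NormedAddCommGroup G] [NormedSpace ℝ G]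
    [FiniteDimensional ℝ G] {b : ℝ × G → ℝ × G →L[ℝ] ℝ} {u₀ : ℝ}
    (hb : ∀ᶠ z in 𝓝 (u₀, (0 : G)), ContDiffAt ℝ ∞ b z)
    (hd : ∀ᶠ z in 𝓝 (u₀, (0 : G)), ∀ v w : G, dForm b z (0, v) (0, w) = 0) :
    ∃ T : ℝ × G → ℝ, ContDiff ℝ ∞ T ∧
      ∀ᶠ z in 𝓝 (u₀, (0 : G)), ∀ v : G, fderiv ℝ T z (0, v) = b z (0, v) := by
  obtain ⟨r, hr, hball⟩ := Metric.eventually_nhds_iff_ball.1 (hb.and hd)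
  -- The cutoff makes the form globally smooth, as the parametric integral lemmas require, and
  -- leaves it unchanged on the ball of radius `r / 3`.
  let χ : ContDiffBump ((u₀, 0) : ℝ × G) := ⟨r / 3, r / 2, by positivity, by linarith⟩
  let b' : ℝ × G → ℝ × G →L[ℝ] ℝ := fun z => χ z • b z
  have hb' : ContDiff ℝ ∞ b' := by
    rw [contDiff_iff_contDiffAt]
    intro z
    by_cases hz : z ∈ Metric.ball ((u₀, 0) : ℝ × G) r
    · exact χ.contDiffAt.smul (hball z hz).1
    · have : b' =ᶠ[𝓝 z] fun _ => 0 := by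
        have hz' : z ∈ (tsupport χ)ᶜ := by
          rw [χ.tsupport_eq]
          intro h
          have h' := Metric.mem_closedBall.1 h
          exact hz (Metric.mem_ball.2 (h'.trans_lt (by change r / 2 < r; linarith)))
        filter_upwards [(isClosed_tsupport χ).isOpen_compl.mem_nhds hz'] with w hw
        simp [b', image_eq_zero_of_notMem_tsupport hw]
      exact contDiffAt_const.congr_of_eventuallyEq this
  have hbb : ∀ z ∈ Metric.ball ((u₀, 0) : ℝ × G) (r / 3), b' =ᶠ[𝓝 z] b := fun z hz => by
    filter_upwards [Metric.isOpen_ball.mem_nhds hz] with w hw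
    simp [b', χ.one_of_mem_closedBall (Metric.ball_subset_closedBall hw)]
  let f : (ℝ × G) × ℝ → ℝ := fun q => b' (q.1.1, q.2 • q.1.2) (0, q.1.2)
  have hf : ContDiff ℝ ∞ f := by
    have h1 : ContDiff ℝ ∞ fun q : (ℝ × G) × ℝ => (q.1.1, q.2 • q.1.2) := by fun_prop
    have h2 : ContDiff ℝ ∞ fun q : (ℝ × G) × ℝ => ((0 : ℝ), q.1.2) := by fun_prop
    exact (hb'.comp h1).clm_apply h2
  refine ⟨fun z => ∫ t in (0 : ℝ)..1, f (z, t), contDiff_infty.2 fun n =>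
    contDiff_parametric_intervalIntegral n (hf.of_le (by exact_mod_cast le_top)), ?_⟩
  filter_upwards [Metric.ball_mem_nhds _ (by positivity : 0 < r / 3)] with z hz v
  have hf1 : ContDiff ℝ 1 f := hf.of_le (by exact_mod_cast le_top)
  rw [(hasFDerivAt_parametric_intervalIntegral hf1 z).fderiv,
    ContinuousLinearMap.intervalIntegral_apply]
  swap
  · refine Continuous.intervalIntegrable ?_ _ _
    exact ((hf1.continuous_fderiv (by simp)).comp (by fun_prop :
      Continuous fun t : ℝ => (z, t))).clm_comp continuous_const
  have hmem : ∀ t ∈ Set.uIcc (0 : ℝ) 1, (z.1, t • z.2) ∈ Metric.ball ((u₀, 0) : ℝ × G) (r / 3) := by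
    intro t ht
    rw [Set.uIcc_of_le zero_le_one] at ht
    rw [mem_ball_iff_norm, Prod.norm_def, max_lt_iff] at hz ⊢
    refine ⟨hz.1, ?_⟩
    have h2 := hz.2
    simp only [Prod.snd_sub, sub_zero, norm_smul] at h2 ⊢
    rw [Real.norm_of_nonneg ht.1]
    exact (mul_le_of_le_one_left (norm_nonneg _) ht.2).trans_lt h2
  -- Closedness along the leaf makes the integrand an exact `t`-derivative; its primitive vanishes
  -- at `t = 0` and equals `b z (0, v)` at `t = 1`.
  have hder : ∀ t ∈ Set.uIcc (0 : ℝ) 1,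
      HasDerivAt (fun t => t * b' (z.1, t • z.2) (0, v))
        ((fderiv ℝ f (z, t)).comp (ContinuousLinearMap.inl ℝ (ℝ × G) ℝ) (0, v)) t := by
    intro t ht
    have hz' := hmem t ht
    have hclosed : fderiv ℝ b' (z.1, t • z.2) (0, v) (0, z.2) =
        fderiv ℝ b' (z.1, t • z.2) (0, z.2) (0, v) := by
      have := (hball _ (Metric.ball_subset_ball (by linarith) hz')).2 v z.2
      rw [← dForm_congr (hbb _ hz')] at this
      exact sub_eq_zero.1 this
    have hB : HasFDerivAt b' (fderiv ℝ b' (z.1, t • z.2)) (z.1, t • z.2) :=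
      (hb'.differentiable (by simp) _).hasFDerivAt
    have h6 : HasDerivAt (fun t : ℝ => ((z.1, t • z.2) : ℝ × G)) (0, z.2) t := by
      simpa using (hasDerivAt_const t z.1).prodMk ((hasDerivAt_id t).smul_const z.2)
    have h7 : HasDerivAt (fun t : ℝ => b' (z.1, t • z.2))
        (fderiv ℝ b' (z.1, t • z.2) (0, z.2)) t := HasFDerivAt.comp_hasDerivAt (l := b') t hB h6
    have h8 : HasDerivAt (fun t : ℝ => b' (z.1, t • z.2) (0, v))
        (fderiv ℝ b' (z.1, t • z.2) (0, z.2) (0, v)) t := by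
      simpa using h7.clm_apply (hasDerivAt_const t ((0 : ℝ), v))
    refine ((hasDerivAt_id t).mul h8).congr_deriv ?_
    rw [fderiv_leafwise_integrand (hb'.of_le (by exact_mod_cast le_top)) rfl hf1, hclosed]
    simp
    ring
  rw [intervalIntegral.integral_eq_sub_of_hasDerivAt hder]
  · simp [(hbb z hz).self_of_nhds]
  · refine Continuous.intervalIntegrable ?_ _ _
    exact (((hf1.continuous_fderiv (by simp)).comp (by fun_prop :
      Continuous fun t : ℝ => (z, t))).clm_comp continuous_const).clm_apply continuous_const

/-- Poincaré lemma for germs of closed 1-forms. -/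
theorem exists_local_primitive {E : Type*} [NormedAddCommGroup E] [NormedSpace ℝ E]
    {g : E → E →L[ℝ] ℝ} {z₀ : E} (hg : ∀ᶠ z in 𝓝 z₀, ContDiffAt ℝ ∞ g z)
    (hdg : ∀ᶠ z in 𝓝 z₀, ∀ v w, dForm g z v w = 0) :
    ∃ f : E → ℝ, ∀ᶠ z in 𝓝 z₀, ContDiffAt ℝ ∞ f z ∧ HasFDerivAt f (g z) z := by
  obtain ⟨r, hr, hball⟩ := Metric.eventually_nhds_iff_ball.1 (hg.and hdg)
  obtain ⟨f, hf⟩ := (convex_ball z₀ r).exists_forall_hasFDerivAt_of_fderiv_symmetric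
    Metric.isOpen_ball (fun z hz => ((hball z hz).1.differentiableAt (by simp)).differentiableWithinAt)
    (fun z hz v w => sub_eq_zero.1 ((hball z hz).2 v w))
  have hs : ContDiffOn ℝ ∞ f (Metric.ball z₀ r) := by
    rw [contDiffOn_infty_iff_fderiv_of_isOpen Metric.isOpen_ball]
    refine ⟨fun z hz => (hf z hz).differentiableAt.differentiableWithinAt, fun z hz => ?_⟩
    exact (hball z hz).1.contDiffWithinAt.congr (fun y hy => (hf y hy).fderiv) (hf z hz).fderiv
  refine ⟨f, ?_⟩
  filter_upwards [Metric.ball_mem_nhds z₀ hr] with z hz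
  exact ⟨hs.contDiffAt (Metric.isOpen_ball.mem_nhds hz), hf z hz⟩

/-- If `dF ≠ 0` and the 1-form `a` is closed along the level sets of `F`, then locally
`a = dt + p dF`. -/
theorem exists_leafwise_normal_form {E : Type} [NormedAddCommGroup E] [NormedSpace ℝ E]
    [FiniteDimensional ℝ E] {a : E → E →L[ℝ] ℝ} {F : E → ℝ} {z₀ : E}
    (ha : ∀ᶠ z in 𝓝 z₀, ContDiffAt ℝ ∞ a z) (hF : ∀ᶠ z in 𝓝 z₀, ContDiffAt ℝ ∞ F z)
    (hda : ∀ᶠ z in 𝓝 z₀, ∀ v w, fderiv ℝ F z v = 0 → fderiv ℝ F z w = 0 → dForm a z v w = 0)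
    (hF₀ : fderiv ℝ F z₀ ≠ 0) :
    ∃ t p : E → ℝ, ∀ᶠ z in 𝓝 z₀, ContDiffAt ℝ ∞ t z ∧ ContDiffAt ℝ ∞ p z ∧
      a z = fderiv ℝ t z + p z • fderiv ℝ F z := by
  have hn : (∞ : ℕ∞ω) ≠ 0 := by simp
  have : CompleteSpace E := FiniteDimensional.complete ℝ E
  set g₀ := fderiv ℝ F z₀ with hg₀
  obtain ⟨e₁, he₁⟩ : ∃ e₁, g₀ e₁ = 1 := by
    obtain ⟨x, hx⟩ := DFunLike.ne_iff.1 hF₀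
    exact ⟨(g₀ x)⁻¹ • x, by simpa using inv_mul_cancel₀ hx⟩
  let K := LinearMap.ker g₀.toLinearMap
  obtain ⟨P₀, hP₀⟩ := K.subtype.exists_leftInverse_of_injective K.ker_subtype
  let P : E →L[ℝ] K := P₀.toContinuousLinearMap
  have hP : ∀ k : K, P k = k := fun k => LinearMap.congr_fun hP₀ k
  -- This map straightens the level sets of `F` into the leaves `{u} × K`, with `K` the tangent
  -- space of the level set at `z₀`.
  let κ : E → ℝ × K := fun z => (F z, P (z - z₀))
  have hκd : ∀ z, DifferentiableAt ℝ F z →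
      HasFDerivAt κ ((fderiv ℝ F z).prod P) z := fun z hz =>
    hz.hasFDerivAt.prodMk (P.hasFDerivAt.comp z ((hasFDerivAt_id z).sub_const z₀))
  have hκ : ∀ᶠ z in 𝓝 z₀, ContDiffAt ℝ ∞ κ z := by
    filter_upwards [hF] with z hz
    exact hz.prodMk (P.contDiff.contDiffAt.comp z (contDiffAt_id.sub contDiffAt_const))
  have hbij : Function.Bijective (g₀.prod P) := by
    constructor
    · rw [injective_iff_map_eq_zero]
      intro x hx
      have h1 : g₀ x = 0 := congrArg Prod.fst hx
      have h2 : P x = 0 := congrArg Prod.snd hx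
      have h3 := hP ⟨x, h1⟩
      rw [h2] at h3
      exact (congrArg Subtype.val h3).symm
    · rintro ⟨c, k⟩
      refine ⟨c • e₁ + ((k - P (c • e₁) : K) : E), ?_⟩
      have hk : ∀ k : K, g₀ k = 0 := fun k => k.2
      simp only [ContinuousLinearMap.prod_apply, map_add, hP, hk]
      simp [he₁]
  let κ' : E ≃L[ℝ] ℝ × K :=
    (LinearEquiv.ofBijective (g₀.prod P).toLinearMap hbij).toContinuousLinearEquiv
  have hκ' : (κ' : E →L[ℝ] ℝ × K) = fderiv ℝ κ z₀ := by
    rw [(hκd z₀ (hF.self_of_nhds.differentiableAt hn)).fderiv]; rfl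
  obtain ⟨e, hz₀, -, heκ, hes, hei⟩ :=
    exists_smooth_openPartialHomeomorph hκ κ' hκ' Filter.univ_mem
  have hκ₀ : e z₀ = (F z₀, (0 : K)) := by rw [heκ]; simp [κ]
  have htgt : ∀ᶠ w in 𝓝 (F z₀, (0 : K)), w ∈ e.target := by
    rw [← hκ₀]; exact e.open_target.mem_nhds (e.map_source hz₀)
  have hsymm : Tendsto e.symm (𝓝 (F z₀, (0 : K))) (𝓝 z₀) := by
    have := e.symm.continuousAt (e.map_source hz₀)
    rwa [ContinuousAt, e.left_inv hz₀, hκ₀] at this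
  have hcs : ∀ w ∈ e.target, ContDiffAt ℝ ∞ e.symm w := fun w hw =>
    hei.contDiffAt (e.open_target.mem_nhds hw)
  let b : ℝ × K → ℝ × K →L[ℝ] ℝ := fun w => (a (e.symm w)).comp (fderiv ℝ e.symm w)
  obtain ⟨T, hT, hTb⟩ := exists_leafwise_primitive (b := b) (u₀ := F z₀)
    (by
      filter_upwards [htgt, hsymm.eventually ha] with w hw haw
      exact (haw.comp w (hcs w hw)).clm_comp ((hcs w hw).fderiv_right (by simp)))
    (by
      filter_upwards [htgt, hsymm.eventually ha, hsymm.eventually hda, hsymm.eventually hF]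
        with w hw haw hdw hFw v v'
      have hsd : DifferentiableAt ℝ e.symm w := (hcs w hw).differentiableAt hn
      -- Leaf directions are carried into `ker dF`, because `F ∘ e.symm` is the first coordinate.
      have key : ∀ v : K, fderiv ℝ F (e.symm w) (fderiv ℝ e.symm w (0, v)) = 0 := by
        intro v
        have h1 : HasFDerivAt (fun w => F (e.symm w))
            ((fderiv ℝ F (e.symm w)).comp (fderiv ℝ e.symm w)) w :=
          (hFw.differentiableAt hn).hasFDerivAt.comp w hsd.hasFDerivAt
        have h2 : (fun w => F (e.symm w)) =ᶠ[𝓝 w] Prod.fst := by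
          filter_upwards [e.open_target.mem_nhds hw] with y hy
          have := e.right_inv hy
          rw [heκ] at this
          exact congrArg Prod.fst this
        have h3 := h1.unique (hasFDerivAt_fst.congr_of_eventuallyEq h2)
        simpa using congrArg (fun L => L (0, v)) h3
      rw [dForm_pullback (haw.differentiableAt hn) ((hcs w hw).of_le (ENat.LEInfty.out))]
      exact hdw _ _ (key v) (key v'))
  have hcont : Tendsto e (𝓝 z₀) (𝓝 (F z₀, (0 : K))) := by
    have := e.continuousAt hz₀
    rwa [ContinuousAt, hκ₀] at this
  have hFc : ContinuousAt (fun z => fderiv ℝ F z e₁) z₀ :=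
    (hF.self_of_nhds.continuousAt_fderiv hn).clm_apply continuousAt_const
  have hne : ∀ᶠ z in 𝓝 z₀, fderiv ℝ F z e₁ ≠ 0 :=
    hFc.eventually_ne (by rw [← hg₀, he₁]; exact one_ne_zero)
  -- The form `a - dt` vanishes on `ker dF`, so it is a multiple of `dF`; the factor is read off on
  -- `e₁`, where `dF` stays nonzero near `z₀`.
  refine ⟨fun z => T (κ z),
    fun z => (a z - fderiv ℝ (fun z => T (κ z)) z) e₁ / fderiv ℝ F z e₁, ?_⟩
  filter_upwards [ha, hF, hκ, hne, hcont.eventually hTb, e.open_source.mem_nhds hz₀]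
    with z haz hFz hκz hnz hTz hzs
  have ht : ContDiffAt ℝ ∞ (fun z => T (κ z)) z := hT.contDiffAt.comp z hκz
  have hdF : ContDiffAt ℝ ∞ (fderiv ℝ F) z := hFz.fderiv_right (by simp)
  refine ⟨ht, ((haz.sub (ht.fderiv_right (by simp))).clm_apply contDiffAt_const).div
    (hdF.clm_apply contDiffAt_const) hnz, ?_⟩
  have hker : ∀ x, fderiv ℝ F z x = 0 → a z x = fderiv ℝ (fun z => T (κ z)) z x := by
    intro x hx
    have hκz' := hκd z (hFz.differentiableAt hn)
    have hw : e z ∈ e.target := e.map_source hzs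
    have h1 : HasFDerivAt (fun z => T (κ z))
        ((fderiv ℝ T (κ z)).comp ((fderiv ℝ F z).prod P)) z :=
      ((hT.differentiable hn) _).hasFDerivAt.comp z hκz'
    have h2 : HasFDerivAt (fun z => e.symm (κ z))
        ((fderiv ℝ e.symm (κ z)).comp ((fderiv ℝ F z).prod P)) z := by
      refine HasFDerivAt.comp z ?_ hκz'
      rw [heκ] at hw
      exact ((hcs _ hw).differentiableAt hn).hasFDerivAt
    have h3 : (fun z => e.symm (κ z)) =ᶠ[𝓝 z] id := by
      filter_upwards [e.open_source.mem_nhds hzs] with y hy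
      rw [← heκ]; exact e.left_inv hy
    have h4 := congrArg (fun L => L x) (h2.unique ((hasFDerivAt_id z).congr_of_eventuallyEq h3))
    have h5 : e.symm (κ z) = z := h3.self_of_nhds
    rw [heκ] at hTz
    have h6 := hTz (P x)
    rw [h1.fderiv]
    simp only [ContinuousLinearMap.comp_apply, ContinuousLinearMap.prod_apply, hx,
      ContinuousLinearMap.id_apply] at h4 ⊢
    rw [h6]
    simp only [b, ContinuousLinearMap.comp_apply, h4, h5]
  ext x
  have h1 := hker (x - (fderiv ℝ F z x / fderiv ℝ F z e₁) • e₁) (by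
    simp only [map_sub, map_smul, smul_eq_mul]; field_simp; ring)
  simp only [map_sub, map_smul, smul_eq_mul] at h1
  simp only [add_apply, smul_apply, sub_apply, smul_eq_mul]
  field_simp
  field_simp at h1
  linarith

/-- Three functionals `a`, `b`, `c` with `a ∧ b ∧ c ≠ 0` take arbitrary values. -/
theorem exists_forall_eq_of_det_ne_zero {V : Type*} [AddCommGroup V] [Module ℝ V]
    (a b c : V →ₗ[ℝ] ℝ) {u v w : V}
    (h : a u * (b v * c w - b w * c v) + a v * (b w * c u - b u * c w) +
      a w * (b u * c v - b v * c u) ≠ 0) (r s t : ℝ) :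
    ∃ x, a x = r ∧ b x = s ∧ c x = t := by
  set D := a u * (b v * c w - b w * c v) + a v * (b w * c u - b u * c w) +
      a w * (b u * c v - b v * c u) with hD
  -- Cramer's rule, with the cofactors written out.
  refine ⟨D⁻¹ • ((r * (b v * c w - b w * c v) + s * (c v * a w - c w * a v)
      + t * (a v * b w - a w * b v)) • u
    + (r * (b w * c u - b u * c w) + s * (c w * a u - c u * a w)
      + t * (a w * b u - a u * b w)) • v
    + (r * (b u * c v - b v * c u) + s * (c u * a v - c v * a u)
      + t * (a u * b v - a v * b u)) • w), ?_, ?_, ?_⟩ <;>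
  · simp only [map_add, map_smul, smul_eq_mul]
    rw [inv_mul_eq_iff_eq_mul₀ h, hD]
    ring

/-- The pair `ker (dt + p dF)`, `ker (dt + (p + 1) dF)` is of type I₂ with `c = 2`, in the
coordinates `(-t, t + F, 1 / p - 1)` if `p = 1` and `t = F = 0` at the base point. -/
theorem exists_typeI2_coordinates {a g : R3 → R3 →L[ℝ] ℝ} {F t p : R3 → ℝ} {z₀ : R3}
    (h : ∀ᶠ z in 𝓝 z₀, ContDiffAt ℝ ∞ F z ∧ ContDiffAt ℝ ∞ t z ∧ ContDiffAt ℝ ∞ p z ∧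
      fderiv ℝ F z = g z ∧ a z = fderiv ℝ t z + p z • g z)
    (hdet : ∃ u v w, a z₀ u * (fderiv ℝ p z₀ v * g z₀ w - fderiv ℝ p z₀ w * g z₀ v) +
      a z₀ v * (fderiv ℝ p z₀ w * g z₀ u - fderiv ℝ p z₀ u * g z₀ w) +
      a z₀ w * (fderiv ℝ p z₀ u * g z₀ v - fderiv ℝ p z₀ v * g z₀ u) ≠ 0)
    {S : Set R3} (hS : S ∈ 𝓝 z₀) :
    ∃ e : OpenPartialHomeomorph R3 R3, z₀ ∈ e.source ∧ e.source ⊆ S ∧ e z₀ = 0 ∧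
      ContDiffOn ℝ ∞ e e.source ∧ ContDiffOn ℝ ∞ e.symm e.target ∧
      ∀ z ∈ e.source, ∀ v,
        (a z v = 0 ↔ fderiv ℝ (fun z => e z 1) z v = e z 2 * fderiv ℝ (fun z => e z 0) z v) ∧
        (a z v + g z v = 0 ↔
          (e z 2 + 2) * fderiv ℝ (fun z => e z 1) z v + fderiv ℝ (fun z => e z 0) z v = 0) := by
  have hn : (∞ : ℕ∞ω) ≠ 0 := by simp
  -- Since `dt + p dF = d(t + c F) + (p - c) dF`, the coefficient can be made `1` at `z₀`. Then it
  -- is invertible nearby and the third coordinate vanishes at `z₀`.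
  let c := p z₀ - 1
  let F₁ : R3 → ℝ := fun z => F z - F z₀
  let p₁ : R3 → ℝ := fun z => p z - c
  let t₁ : R3 → ℝ := fun z => t z + c * F z - (t z₀ + c * F z₀)
  let χ : R3 → R3 := fun z => !₂[-t₁ z, t₁ z + F₁ z, (p₁ z)⁻¹ - 1]
  have hp₁ : p₁ z₀ = 1 := by simp [p₁, c]
  have hpc : ∀ᶠ z in 𝓝 z₀, p₁ z ≠ 0 := by
    have : ContinuousAt p₁ z₀ := h.self_of_nhds.2.2.1.continuousAt.sub continuousAt_const
    exact this.eventually_ne (by rw [hp₁]; exact one_ne_zero)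
  have hs : ∀ᶠ z in 𝓝 z₀, ContDiffAt ℝ ∞ F₁ z ∧ ContDiffAt ℝ ∞ t₁ z ∧ ContDiffAt ℝ ∞ p₁ z ∧
      fderiv ℝ F₁ z = g z ∧ fderiv ℝ p₁ z = fderiv ℝ p z ∧
      a z = fderiv ℝ t₁ z + p₁ z • g z := by
    filter_upwards [h] with z ⟨hF, ht, hp, hg, ha⟩
    have hcF : ContDiffAt ℝ ∞ (fun z => c * F z) z := contDiffAt_const.mul hF
    refine ⟨hF.sub contDiffAt_const, (ht.add hcF).sub contDiffAt_const, hp.sub contDiffAt_const,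
      (fderiv_sub_const _).trans hg, fderiv_sub_const _, ?_⟩
    have : fderiv ℝ t₁ z = fderiv ℝ t z + c • g z := by
      rw [fderiv_sub_const, fderiv_fun_add (ht.differentiableAt hn) (hcF.differentiableAt hn),
        fderiv_const_mul (hF.differentiableAt hn), hg]
    rw [this, ha]
    ext v
    simp [p₁]
    ring
  have hχ : ∀ᶠ z in 𝓝 z₀, ContDiffAt ℝ ∞ χ z := by
    filter_upwards [hs, hpc] with z ⟨hF, ht, hp, _⟩ hpz
    rw [contDiffAt_euclidean]
    intro i
    fin_cases i
    · exact ht.neg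
    · exact ht.add hF
    · exact (hp.inv hpz).sub contDiffAt_const
  have hcoord : ∀ z, DifferentiableAt ℝ χ z → ∀ i v,
      fderiv ℝ χ z v i = fderiv ℝ (fun z => χ z i) z v := by
    intro z hz i v
    have := ((EuclideanSpace.proj i : R3 →L[ℝ] ℝ).hasFDerivAt.comp z
      hz.hasFDerivAt).fderiv
    exact (congrArg (fun L => L v) this).symm
  have hd : ∀ᶠ z in 𝓝 z₀, ∀ v, fderiv ℝ (fun z => χ z 0) z v = -fderiv ℝ t₁ z v ∧
      fderiv ℝ (fun z => χ z 1) z v = fderiv ℝ t₁ z v + g z v ∧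
      fderiv ℝ (fun z => χ z 2) z v = -(p₁ z ^ 2)⁻¹ * fderiv ℝ p z v := by
    filter_upwards [hs, hpc] with z ⟨hF, ht, hp, hg, hp', _⟩ hpz v
    refine ⟨?_, ?_, ?_⟩
    · change fderiv ℝ (fun z => -t₁ z) z v = _
      simp
    · change fderiv ℝ (fun z => t₁ z + F₁ z) z v = _
      rw [fderiv_fun_add (ht.differentiableAt hn) (hF.differentiableAt hn), hg]; rfl
    · change fderiv ℝ (fun z => (p₁ z)⁻¹ - 1) z v = _
      have := ((hasDerivAt_inv hpz).comp_hasFDerivAt z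
        (hp.differentiableAt hn).hasFDerivAt).sub_const 1
      rw [hp'] at this
      exact congrArg (fun L => L v) this.fderiv
  have hsurj : Function.Surjective (fderiv ℝ χ z₀) := by
    obtain ⟨u, v, w, huvw⟩ := hdet
    intro y
    -- As `p₁ = 1` at `z₀`, the differentials of the three coordinates there are `g - a`, `a` and
    -- `-dp`; the prescribed values solve for `y`.
    obtain ⟨x, hx1, hx2, hx3⟩ := exists_forall_eq_of_det_ne_zero (a z₀).toLinearMap
      (fderiv ℝ p z₀).toLinearMap (g z₀).toLinearMap huvw (y 1) (-(y 2)) (y 0 + y 1)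
    obtain ⟨-, -, -, -, -, ha⟩ := hs.self_of_nhds
    have hax := congrArg (fun L => L x) ha
    simp only [add_apply, smul_apply, hp₁, smul_eq_mul,
      one_mul] at hax
    simp only [ContinuousLinearMap.coe_coe] at hx1 hx2 hx3
    obtain ⟨h1, h2, h3⟩ := hd.self_of_nhds x
    refine ⟨x, ?_⟩
    ext i
    rw [hcoord z₀ (hχ.self_of_nhds.differentiableAt hn)]
    fin_cases i
    · change fderiv ℝ (fun z => χ z 0) z₀ x = y 0
      linarith
    · change fderiv ℝ (fun z => χ z 1) z₀ x = y 1
      linarith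
    · change fderiv ℝ (fun z => χ z 2) z₀ x = y 2
      rw [h3, hp₁, hx2]; norm_num
  have hbij : Function.Bijective (fderiv ℝ χ z₀).toLinearMap :=
    ⟨LinearMap.injective_iff_surjective.2 hsurj, hsurj⟩
  obtain ⟨e, hz₀, heS, heχ, hes, hei⟩ := exists_smooth_openPartialHomeomorph hχ
    (LinearEquiv.ofBijective _ hbij).toContinuousLinearEquiv rfl (Filter.inter_mem hS
      (hs.and (hpc.and hd)))
  refine ⟨e, hz₀, fun z hz => (heS hz).1, ?_, hes, hei, fun z hz v => ?_⟩
  · rw [heχ]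
    ext i
    fin_cases i
    · simp [χ, t₁]
    · simp [χ, t₁, F₁]
    · simp [χ, hp₁]
  · obtain ⟨-, ⟨-, -, -, -, -, ha⟩, hpz, hdz⟩ := heS hz
    obtain ⟨h1, h2, -⟩ := hdz v
    have h3 : χ z 2 = (p₁ z)⁻¹ - 1 := rfl
    rw [heχ, h1, h2, h3, ha]
    simp only [add_apply, smul_apply, smul_eq_mul]
    -- Both equivalences clear the denominator in `dy - P dx = a / p₁` and `(P + 2) dy + dx = (a +
    -- g) / p₁`.
    constructor <;> constructor <;> intro h
    · field_simp; linarith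
    · field_simp at h; linarith
    · field_simp; linarith
    · field_simp at h; linarith

end NormalForm

/-! ### Forms read in the preferred charts. -/

section Charts

open Filter

variable {M : Type*} [TopologicalSpace M] [ChartedSpace R3 M]

/-- The derivative of the preferred chart at `m`, at the point `q`. -/
def dChart (m q : M) : TangentSpace (𝓡 3) q →L[ℝ] R3 :=
  mfderiv (𝓡 3) 𝓘(ℝ, R3) (extChartAt (𝓡 3) m) q

/-- The derivative of the inverse of the preferred chart at `m`. -/
def dChartSymm (m : M) (z : R3) : R3 →L[ℝ] TangentSpace (𝓡 3) ((extChartAt (𝓡 3) m).symm z) :=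
  mfderiv 𝓘(ℝ, R3) (𝓡 3) (extChartAt (𝓡 3) m).symm z

theorem inChart_apply (α : OneForm M) (m : M) (z v : R3) :
    inChart α m z v = α ((extChartAt (𝓡 3) m).symm z) (dChartSymm m z v) := rfl

variable [IsManifold (𝓡 3) ∞ M]

theorem isManifold_one : IsManifold (𝓡 3) 1 M := .of_le (n := ∞) (by simp)

theorem dChartSymm_dChart' {m : M} {z : R3} (hz : z ∈ (extChartAt (𝓡 3) m).target)
    (v : TangentSpace (𝓡 3) ((extChartAt (𝓡 3) m).symm z)) :
    dChartSymm m z (dChart m ((extChartAt (𝓡 3) m).symm z) v) = v := by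
  have := isManifold_one (M := M)
  have h := mfderivWithin_extChartAt_symm_comp_mfderiv_extChartAt (I := 𝓡 3) hz
  rw [ModelWithCorners.range_eq_univ, mfderivWithin_univ] at h
  exact congrArg (fun L => L v) h

theorem inChart_dChart' (α : OneForm M) {m : M} {z : R3} (hz : z ∈ (extChartAt (𝓡 3) m).target)
    (v : TangentSpace (𝓡 3) ((extChartAt (𝓡 3) m).symm z)) :
    inChart α m z (dChart m ((extChartAt (𝓡 3) m).symm z) v) =
      α ((extChartAt (𝓡 3) m).symm z) v := by
  rw [inChart_apply, dChartSymm_dChart' hz]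

theorem inChart_dChart (α : OneForm M) {m q : M} (hq : q ∈ (extChartAt (𝓡 3) m).source)
    (v : TangentSpace (𝓡 3) q) :
    inChart α m (extChartAt (𝓡 3) m q) (dChart m q v) = α q v := by
  obtain ⟨z, hz, rfl⟩ : ∃ z ∈ (extChartAt (𝓡 3) m).target, (extChartAt (𝓡 3) m).symm z = q :=
    ⟨_, (extChartAt (𝓡 3) m).map_source hq, (extChartAt (𝓡 3) m).left_inv hq⟩
  rw [(extChartAt (𝓡 3) m).right_inv hz, inChart_dChart' α hz]

theorem contMDiffAt_extChartAt_symm {m : M} {z : R3} (hz : z ∈ (extChartAt (𝓡 3) m).target) :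
    ContMDiffAt 𝓘(ℝ, R3) (𝓡 3) ∞ (extChartAt (𝓡 3) m).symm z :=
  (contMDiffOn_extChartAt_symm m).contMDiffAt ((isOpen_extChartAt_target m).mem_nhds hz)

theorem contMDiffAt_extChartAt_of_mem {m q : M} (hq : q ∈ (extChartAt (𝓡 3) m).source) :
    ContMDiffAt (𝓡 3) 𝓘(ℝ, R3) ∞ (extChartAt (𝓡 3) m) q :=
  contMDiffAt_extChartAt' (by rwa [extChartAt_source] at hq)

/-- The trivialization of the tangent bundle at `m` has the derivative of the inverse chart as its
inverse on fibres, so the trivialized section is `inChart α m`. -/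
theorem contDiffAt_inChart {α : OneForm M} {U : Set M} (hα : SmoothOneFormOn α U) {m : M} {z : R3}
    (hz : z ∈ (extChartAt (𝓡 3) m).target) (hU : U ∈ 𝓝 ((extChartAt (𝓡 3) m).symm z)) :
    ContDiffAt ℝ ∞ (inChart α m) z := by
  have := isManifold_one (M := M)
  set q := (extChartAt (𝓡 3) m).symm z with hq
  have hqs : q ∈ (chartAt R3 m).source := by
    rw [← extChartAt_source (𝓡 3)]; exact (extChartAt (𝓡 3) m).map_target hz
  have h1 := hα.contMDiffAt hU
  let e := trivializationAt (R3 →L[ℝ] ℝ)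
    (fun q : M => TangentSpace (𝓡 3) q →L[ℝ] (Bundle.Trivial M ℝ q)) m
  have hqb : q ∈ e.baseSet := by
    simp only [e, hom_trivializationAt_baseSet]
    exact ⟨hqs, Set.mem_univ _⟩
  have h2 : ContMDiffAt (𝓡 3) 𝓘(ℝ, R3 →L[ℝ] ℝ) ∞ (fun x => (e ⟨x, α x⟩).2) q :=
    (Trivialization.contMDiffAt_section_iff e hqb).1 h1
  have h3 : ContMDiffAt 𝓘(ℝ, R3) 𝓘(ℝ, R3 →L[ℝ] ℝ) ∞
      (fun z => (e ⟨(extChartAt (𝓡 3) m).symm z, α ((extChartAt (𝓡 3) m).symm z)⟩).2) z :=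
    h2.comp z (contMDiffAt_extChartAt_symm hz)
  refine h3.contDiffAt.congr_of_eventuallyEq ?_
  filter_upwards [(isOpen_extChartAt_target m).mem_nhds hz] with w hw
  have hws : (extChartAt (𝓡 3) m).symm w ∈ (chartAt R3 m).source := by
    rw [← extChartAt_source (𝓡 3)]; exact (extChartAt (𝓡 3) m).map_target hw
  have h4 := TangentBundle.symmL_trivializationAt (I := 𝓡 3) hws
  rw [ModelWithCorners.range_eq_univ, mfderivWithin_univ,
    (extChartAt (𝓡 3) m).right_inv hw] at h4
  ext v
  rw [inChart_apply]
  simp only [e, hom_trivializationAt_apply, ContinuousLinearMap.inCoordinates,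
    ContinuousLinearMap.comp_apply, h4]
  simp [dChartSymm]
  rfl

theorem contDiffAt_comp_extChartAt_symm {f : M → ℝ} {m : M} {z : R3}
    (hz : z ∈ (extChartAt (𝓡 3) m).target)
    (hf : ContMDiffAt (𝓡 3) 𝓘(ℝ, ℝ) ∞ f ((extChartAt (𝓡 3) m).symm z)) :
    ContDiffAt ℝ ∞ (fun w => f ((extChartAt (𝓡 3) m).symm w)) z :=
  (hf.comp z (contMDiffAt_extChartAt_symm hz)).contDiffAt

/-- A form that is closed is closed in every chart. -/
theorem dForm_inChart_of_closed {γ : OneForm M} (hγ : IsClosedForm γ) {m : M} {z : R3}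
    (hz : z ∈ (extChartAt (𝓡 3) m).target) (v w : R3) : dForm (inChart γ m) z v w = 0 := by
  set q := (extChartAt (𝓡 3) m).symm z with hq
  -- Closedness at `q` is stated in the chart at `q`; the transition map carries it to the chart at
  -- `m`.
  let τ : R3 → R3 := fun y => extChartAt (𝓡 3) q ((extChartAt (𝓡 3) m).symm y)
  have hτ : ∀ y ∈ (extChartAt (𝓡 3) m).target,
      (extChartAt (𝓡 3) m).symm y ∈ (extChartAt (𝓡 3) q).source →
      ContDiffAt ℝ ∞ τ y ∧ ∀ v, fderiv ℝ τ y v =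
        dChart q ((extChartAt (𝓡 3) m).symm y) (dChartSymm m y v) := by
    intro y hy hy'
    have h1 := contMDiffAt_extChartAt_symm hy
    have h2 := contMDiffAt_extChartAt_of_mem hy'
    refine ⟨(h2.comp y h1).contDiffAt, fun v => ?_⟩
    have h3 := mfderiv_comp y (h2.mdifferentiableAt (by simp)) (h1.mdifferentiableAt (by simp))
    rw [mfderiv_eq_fderiv] at h3
    exact congrArg (fun L => L v) h3
  have hev : ∀ᶠ y in 𝓝 z, y ∈ (extChartAt (𝓡 3) m).target ∧
      (extChartAt (𝓡 3) m).symm y ∈ (extChartAt (𝓡 3) q).source :=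
    (eventually_mem_set.2 ((isOpen_extChartAt_target m).mem_nhds hz)).and
      ((contMDiffAt_extChartAt_symm hz).continuousAt.eventually
        (eventually_mem_set.2 (extChartAt_source_mem_nhds q)))
  have hpull : inChart γ m =ᶠ[𝓝 z] fun y => (inChart γ q (τ y)).comp (fderiv ℝ τ y) := by
    filter_upwards [hev] with y ⟨hy, hy'⟩
    ext v
    rw [ContinuousLinearMap.comp_apply, (hτ y hy hy').2, inChart_apply]
    exact (inChart_dChart γ hy' _).symm
  obtain ⟨hz1, hz2⟩ := hev.self_of_nhds
  rw [dForm_congr hpull, dForm_pullback _ ((hτ z hz1 hz2).1.of_le ENat.LEInfty.out)]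
  · exact hγ.closed q _ _
  · refine (contDiffAt_inChart hγ.smooth ((extChartAt (𝓡 3) q).map_source hz2)
      Filter.univ_mem).differentiableAt (by simp)

end Charts

/-! ### What the local flow of `Y` preserves. -/

section Flows

open Filter

variable {M : Type*} [TopologicalSpace M] [ChartedSpace R3 M]

section

variable {Y : VField M} {U : Set M} {ε : ℝ} {Φ : ℝ → M → M}

theorem IsLocalFlow.mem_nhds (hΦ : IsLocalFlow Y U ε Φ) {t : ℝ} (ht : t ∈ Set.Ioo (-ε) ε) {q : M}
    (hq : q ∈ U) : Set.Ioo (-ε) ε ×ˢ U ∈ 𝓝 (t, q) :=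
  prod_mem_nhds (isOpen_Ioo.mem_nhds ht) (hΦ.isOpen.mem_nhds hq)

theorem IsLocalFlow.contMDiffAt (hΦ : IsLocalFlow Y U ε Φ) {t : ℝ} (ht : t ∈ Set.Ioo (-ε) ε)
    {q : M} (hq : q ∈ U) :
    ContMDiffAt (𝓘(ℝ, ℝ).prod (𝓡 3)) (𝓡 3) ∞ (fun z : ℝ × M => Φ z.1 z.2) (t, q) :=
  hΦ.smooth.contMDiffAt (hΦ.mem_nhds ht hq)

theorem IsLocalFlow.contMDiffAt_space (hΦ : IsLocalFlow Y U ε Φ) {t : ℝ}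
    (ht : t ∈ Set.Ioo (-ε) ε) {q : M} (hq : q ∈ U) : ContMDiffAt (𝓡 3) (𝓡 3) ∞ (Φ t) q :=
  (hΦ.contMDiffAt ht hq).comp q (contMDiffAt_const.prodMk contMDiffAt_id)

theorem IsLocalFlow.hasMFDerivAt_space (hΦ : IsLocalFlow Y U ε Φ) {t : ℝ}
    (ht : t ∈ Set.Ioo (-ε) ε) {q : M} (hq : q ∈ U) :
    HasMFDerivAt (𝓡 3) (𝓡 3) (Φ t) q (mfderiv (𝓡 3) (𝓡 3) (Φ t) q) :=
  ((hΦ.contMDiffAt_space ht hq).mdifferentiableAt (by simp)).hasMFDerivAt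

theorem IsLocalFlow.hasMFDerivAt_time (hΦ : IsLocalFlow Y U ε Φ) {t : ℝ}
    (ht : t ∈ Set.Ioo (-ε) ε) {q : M} (hq : q ∈ U) :
    HasMFDerivAt 𝓘(ℝ, ℝ) (𝓡 3) (fun t => Φ t q) t
      ((1 : ℝ →L[ℝ] ℝ).smulRight (Y (Φ t q))) :=
  (hΦ.integralCurve q hq t ht).hasMFDerivAt (isOpen_Ioo.mem_nhds ht)

theorem IsLocalFlow.zero_mem (hΦ : IsLocalFlow Y U ε Φ) : (0 : ℝ) ∈ Set.Ioo (-ε) ε :=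
  ⟨neg_neg_iff_pos.2 hΦ.pos, hΦ.pos⟩

end

/-- A function is constant along the flow lines that stay where its derivative along the field
vanishes. -/
theorem IsLocalFlow.eq_of_mfderiv_eq_zero {Y : VField M} {U : Set M} {ε : ℝ} {Φ : ℝ → M → M}
    (hΦ : IsLocalFlow Y U ε Φ) {f : M → ℝ} {q : M} (hq : q ∈ U) {J : Set ℝ} (hJ : IsOpen J)
    (hJc : IsPreconnected J) (hJε : J ⊆ Set.Ioo (-ε) ε)
    (hf : ∀ t ∈ J, MDifferentiableAt (𝓡 3) 𝓘(ℝ, ℝ) f (Φ t q) ∧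
      mfderiv (𝓡 3) 𝓘(ℝ, ℝ) f (Φ t q) (Y (Φ t q)) = (0 : ℝ)) {s t : ℝ} (hs : s ∈ J) (ht : t ∈ J) :
    f (Φ s q) = f (Φ t q) := by
  have hd : ∀ t ∈ J, HasDerivAt (fun t => f (Φ t q)) 0 t := by
    intro t ht
    let l : ℝ →L[ℝ] ℝ := (mfderiv (𝓡 3) 𝓘(ℝ, ℝ) f (Φ t q)).comp
      ((1 : ℝ →L[ℝ] ℝ).smulRight (Y (Φ t q)))
    have h1 : HasMFDerivAt 𝓘(ℝ, ℝ) 𝓘(ℝ, ℝ) (fun t => f (Φ t q)) t l :=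
      (hf t ht).1.hasMFDerivAt.comp t (hΦ.hasMFDerivAt_time (hJε ht) hq)
    have h2 : HasFDerivAt (fun t => f (Φ t q)) l t := h1.hasFDerivAt
    refine h2.hasDerivAt.congr_deriv ?_
    refine Eq.trans ?_ (hf t ht).2
    change mfderiv (𝓡 3) 𝓘(ℝ, ℝ) f (Φ t q) ((1 : ℝ) • Y (Φ t q)) = _
    rw [one_smul]
  exact hJ.is_const_of_deriv_eq_zero hJc
    (fun t ht => (hd t ht).differentiableAt.differentiableWithinAt)
    (fun t ht => (hd t ht).deriv) hs ht

variable [IsManifold (𝓡 3) ∞ M]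

/-- A closed form has local primitives. -/
theorem IsClosedForm.exists_primitive {γ : OneForm M} (hγ : IsClosedForm γ) (m : M) :
    ∃ f : M → ℝ, ∀ᶠ q in 𝓝 m, MDifferentiableAt (𝓡 3) 𝓘(ℝ, ℝ) f q ∧
      ∀ v : TangentSpace (𝓡 3) q, mfderiv (𝓡 3) 𝓘(ℝ, ℝ) f q v = γ q v := by
  have htgt : ∀ᶠ z in 𝓝 (extChartAt (𝓡 3) m m), z ∈ (extChartAt (𝓡 3) m).target :=
    extChartAt_target_mem_nhds m
  obtain ⟨f, hf⟩ := exists_local_primitive (g := inChart γ m)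
    (htgt.mono fun z hz => contDiffAt_inChart hγ.smooth hz Filter.univ_mem)
    (htgt.mono fun z hz => dForm_inChart_of_closed hγ hz)
  refine ⟨fun q => f (extChartAt (𝓡 3) m q), ?_⟩
  filter_upwards [(continuousAt_extChartAt (I := 𝓡 3) m).eventually hf,
    extChartAt_source_mem_nhds (I := 𝓡 3) m]
    with q hfq hq
  have h1 := hfq.2.hasMFDerivAt.comp q
    ((contMDiffAt_extChartAt_of_mem hq).mdifferentiableAt (by simp)).hasMFDerivAt
  refine ⟨h1.mdifferentiableAt, fun v => ?_⟩
  have h2 := congrArg (fun L => L v) h1.mfderiv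
  exact h2.trans (inChart_dChart γ hq v)

/-- The flow of `Y` preserves a closed form that vanishes on `Y`. -/
theorem IsLocalFlow.pullback_closed {Y : VField M} {U : Set M} {ε : ℝ} {Φ : ℝ → M → M}
    (hΦ : IsLocalFlow Y U ε Φ) {γ : OneForm M} (hγ : IsClosedForm γ) (hγY : ∀ q, γ q (Y q) = 0)
    {t : ℝ} (ht : t ∈ Set.Ioo (-ε) ε) {q : M} (hq : q ∈ U) (v : TangentSpace (𝓡 3) q) :
    γ (Φ t q) (mfderiv (𝓡 3) (𝓡 3) (Φ t) q v) = γ q v := by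
  let c : ℝ → ℝ := fun t => γ (Φ t q) (mfderiv (𝓡 3) (𝓡 3) (Φ t) q v)
  -- Near `Φ t₀ q` write `γ = df`. As `df(Y) = 0`, the functions `f ∘ Φ t` and `f ∘ Φ t₀` agree near
  -- `q` for `t` close to `t₀`; comparing their spatial derivatives gives local constancy in `t`.
  have hloc : ∀ t₀ ∈ Set.Ioo (-ε) ε, c =ᶠ[𝓝 t₀] fun _ => c t₀ := by
    intro t₀ ht₀
    obtain ⟨f, hf⟩ := hγ.exists_primitive (Φ t₀ q)
    have h1 := ((hΦ.contMDiffAt ht₀ hq).continuousAt.eventually hf).and (hΦ.mem_nhds ht₀ hq)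
    rw [nhds_prod_eq] at h1
    obtain ⟨p₁, hp₁, p₂, hp₂, hp⟩ := eventually_prod_iff.1 h1
    obtain ⟨δ, hδ, hball⟩ := Metric.eventually_nhds_iff_ball.1 hp₁
    have hconst : ∀ t ∈ Metric.ball t₀ δ, ∀ q', p₂ q' → f (Φ t q') = f (Φ t₀ q') := by
      intro t ht q' hq'
      refine hΦ.eq_of_mfderiv_eq_zero (hp hp₁.self_of_nhds hq').2.2 Metric.isOpen_ball
        (convex_ball t₀ δ).isPreconnected (fun s hs => (hp (hball s hs) hq').2.1) (fun s hs => ?_)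
        ht (Metric.mem_ball_self hδ)
      obtain ⟨h2, h3⟩ := (hp (hball s hs) hq').1
      exact ⟨h2, (h3 _).trans (hγY _)⟩
    have hder : ∀ t ∈ Metric.ball t₀ δ,
        HasMFDerivAt (𝓡 3) 𝓘(ℝ, ℝ) (fun q' => f (Φ t q')) q
          ((mfderiv (𝓡 3) 𝓘(ℝ, ℝ) f (Φ t q)).comp (mfderiv (𝓡 3) (𝓡 3) (Φ t) q)) := by
      intro t ht
      obtain ⟨⟨h2, -⟩, h4⟩ := hp (hball t ht) hp₂.self_of_nhds
      exact h2.hasMFDerivAt.comp q (hΦ.hasMFDerivAt_space h4.1 hq)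
    filter_upwards [Metric.ball_mem_nhds t₀ hδ] with t ht
    have h5 : (fun q' => f (Φ t q')) =ᶠ[𝓝 q] fun q' => f (Φ t₀ q') := by
      filter_upwards [hp₂] with q' hq' using hconst t ht q' hq'
    have h6 := hasMFDerivAt_unique ((hder t₀ (Metric.mem_ball_self hδ)).congr_of_eventuallyEq h5)
      (hder t ht)
    have h7 := (hp (hball t ht) hp₂.self_of_nhds).1.2 (mfderiv (𝓡 3) (𝓡 3) (Φ t) q v)
    have h8 := (hp hp₁.self_of_nhds hp₂.self_of_nhds).1.2 (mfderiv (𝓡 3) (𝓡 3) (Φ t₀) q v)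
    exact h7.symm.trans ((congrArg (fun L => L v) h6).symm.trans h8)
  have h0 : c 0 = γ q v := by
    have hid : mfderiv (𝓡 3) (𝓡 3) (Φ 0) q v = v := by
      have : Φ 0 =ᶠ[𝓝 q] id := by
        filter_upwards [hΦ.isOpen.mem_nhds hq] with q' hq' using hΦ.zero q' hq'
      have h1 := ((hasMFDerivAt_id (I := 𝓡 3) q).congr_of_eventuallyEq this).mfderiv
      exact congrArg (fun L => L v) h1
    have hq0 := hΦ.zero q hq
    change γ (Φ 0 q) (mfderiv (𝓡 3) (𝓡 3) (Φ 0) q v) = _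
    rw [hid, hq0]
  have hd : ∀ t ∈ Set.Ioo (-ε) ε, HasDerivAt c 0 t := fun t ht =>
    (hasDerivAt_const t _).congr_of_eventuallyEq (hloc t ht)
  rw [← h0]
  exact isOpen_Ioo.is_const_of_deriv_eq_zero isPreconnected_Ioo
    (fun t ht => (hd t ht).differentiableAt.differentiableWithinAt)
    (fun t ht => (hd t ht).deriv) ht hΦ.zero_mem

/-- The flow of `Y` preserves `Y`. -/
theorem IsLocalFlow.mfderiv_apply_field [T2Space M] {Y : VField M} {U : Set M} {ε : ℝ}
    {Φ : ℝ → M → M} (hΦ : IsLocalFlow Y U ε Φ) (hY : SmoothVFieldOn Y Set.univ)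
    {t : ℝ} (ht : t ∈ Set.Ioo (-ε) ε) {q : M} (hq : q ∈ U) :
    mfderiv (𝓡 3) (𝓡 3) (Φ t) q (Y q) = Y (Φ t q) := by
  have := isManifold_one (M := M)
  have hY1 : ContMDiff (𝓡 3) (𝓡 3).tangent 1 (fun q => (⟨q, Y q⟩ : TangentBundle (𝓡 3) M)) :=
    (contMDiffOn_univ.1 hY).of_le (by simp)
  have h00 := hΦ.zero_mem
  have h0 := hΦ.hasMFDerivAt_time h00 hq
  have hcomm : (fun s => Φ t (Φ s q)) =ᶠ[𝓝 0] fun s => Φ (t + s) q := by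
    have h1 : ∀ᶠ s in 𝓝 (0 : ℝ), Φ s q ∈ U := by
      refine h0.continuousAt.eventually (hΦ.isOpen.mem_nhds ?_)
      change Φ 0 q ∈ U
      rwa [hΦ.zero q hq]
    have h2 : ∀ᶠ s in 𝓝 (0 : ℝ), s ∈ Set.Ioo (-ε) ε := isOpen_Ioo.mem_nhds h00
    have h3 : ∀ᶠ s in 𝓝 (0 : ℝ), t + s ∈ Set.Ioo (-ε) ε :=
      (continuous_const.add continuous_id).continuousAt.eventually
        (isOpen_Ioo.mem_nhds (by simpa using ht))
    filter_upwards [h1, h2, h3] with s hs1 hs2 hs3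
    -- On `(A, B)` both curves are defined: `t'` and `t' + s` lie in `(-ε, ε)`.
    let A := max (-ε) (-ε - s)
    let B := min ε (ε - s)
    have hc1 : IsMIntegralCurveOn (fun t' => Φ t' (Φ s q)) Y (Set.Ioo A B) :=
      (hΦ.integralCurve _ hs1).mono (Set.Ioo_subset_Ioo (le_max_left _ _) (min_le_left _ _))
    have hc2 : IsMIntegralCurveOn ((fun t' => Φ t' q) ∘ (· + s)) Y (Set.Ioo A B) := by
      refine ((hΦ.integralCurve q hq).comp_add s).mono fun x hx => ?_
      have h4 := (le_max_right _ _).trans_lt hx.1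
      have h5 := hx.2.trans_le (min_le_right _ _)
      exact ⟨by linarith, by linarith⟩
    refine isMIntegralCurveOn_Ioo_eqOn_of_contMDiff_boundaryless (t₀ := 0) ?_ hY1 hc1 hc2 ?_ ?_
    · exact ⟨max_lt h00.1 (by linarith [hs2.1, hs2.2]), lt_min h00.2 (by linarith [hs2.1, hs2.2])⟩
    · simp [hΦ.zero _ hs1]
    · exact ⟨max_lt ht.1 (by linarith [hs3.1]), lt_min ht.2 (by linarith [hs3.2])⟩
  have h1 : HasMFDerivAt 𝓘(ℝ, ℝ) (𝓡 3) (fun s => Φ t (Φ s q)) 0 _ :=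
    (hΦ.hasMFDerivAt_space ht (by rwa [hΦ.zero q hq] : Φ 0 q ∈ U)).comp 0 h0
  have h2 : HasMFDerivAt 𝓘(ℝ, ℝ) (𝓡 3) (fun s => Φ (t + s) q) 0
      ((1 : ℝ →L[ℝ] ℝ).smulRight (Y (Φ (t + 0) q))) := by
    have h3 : HasMFDerivAt 𝓘(ℝ, ℝ) 𝓘(ℝ, ℝ) (fun s : ℝ => t + s) 0 (ContinuousLinearMap.id ℝ ℝ) :=
      ((hasFDerivAt_id (0 : ℝ)).const_add t).hasMFDerivAt
    exact (hΦ.hasMFDerivAt_time (by simpa using ht) hq).comp 0 h3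
  have h4 := congrArg (fun L => L (1 : ℝ)) (hasMFDerivAt_unique h1 (h2.congr_of_eventuallyEq hcomm))
  have h5 : mfderiv (𝓡 3) (𝓡 3) (Φ t) (Φ 0 q) ((1 : ℝ) • Y (Φ 0 q)) = (1 : ℝ) • Y (Φ (t + 0) q) :=
    h4
  rw [hΦ.zero q hq, one_smul, one_smul, add_zero] at h5
  exact h5

/-- If the flow of `Y` preserves `ker α` and `α(Y) = 1` then it preserves `α`. -/
theorem IsLocalFlow.pullback_of_preserves [T2Space M] {Y : VField M} {U : Set M} {ε : ℝ}
    {Φ : ℝ → M → M} (hΦ : IsLocalFlow Y U ε Φ) (hY : SmoothVFieldOn Y Set.univ) {α : OneForm M}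
    (hα : FlowPreserves Y (kerField α)) (hαY : ∀ q, α q (Y q) = 1)
    {t : ℝ} (ht : t ∈ Set.Ioo (-ε) ε) {q : M} (hq : q ∈ U) (v : TangentSpace (𝓡 3) q) :
    α (Φ t q) (mfderiv (𝓡 3) (𝓡 3) (Φ t) q v) = α q v := by
  have h1 : v - α q v • Y q ∈ kerField α q := by
    change α q (v - α q v • Y q) = 0
    rw [map_sub, map_smul, hαY]; simp
  have h2 : α (Φ t q) (mfderiv (𝓡 3) (𝓡 3) (Φ t) q (v - α q v • Y q)) = 0 := by
    have := Submodule.mem_map_of_mem (f := (mfderiv (𝓡 3) (𝓡 3) (Φ t) q).toLinearMap) h1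
    rw [hα.2 U ε Φ hΦ t ht q hq] at this
    exact this
  rw [map_sub, map_smul, hΦ.mfderiv_apply_field hY ht hq, map_sub, map_smul, hαY] at h2
  simpa [sub_eq_zero] using h2

end Flows

/-! ### From flow invariance to `α = dt + p dF`. -/

section LocalForm

open Filter

variable {M : Type*} [TopologicalSpace M] [ChartedSpace R3 M] [IsManifold (𝓡 3) ∞ M]

/-- A form invariant under the local flows of `Y`, with `α(Y) = 1`, satisfies `i_Y dα = 0` (in the
chart at `m`, near the base point). -/
theorem eventually_dForm_field_eq_zero {Y : VField M} {U : Set M} {ε : ℝ} {Φ : ℝ → M → M}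
    (hΦ : IsLocalFlow Y U ε Φ) {α : OneForm M} (hα : SmoothOneFormOn α Set.univ)
    (hαY : ∀ q, α q (Y q) = 1)
    (hinv : ∀ t ∈ Set.Ioo (-ε) ε, ∀ q ∈ U, ∀ v : TangentSpace (𝓡 3) q,
      α (Φ t q) (mfderiv (𝓡 3) (𝓡 3) (Φ t) q v) = α q v) {m : M} (hm : m ∈ U) :
    ∀ᶠ z in 𝓝 (extChartAt (𝓡 3) m m), ∀ w : R3,
      dForm (inChart α m) z (dChart m ((extChartAt (𝓡 3) m).symm z)
        (Y ((extChartAt (𝓡 3) m).symm z))) w = 0 := by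
  set ψ := extChartAt (𝓡 3) m with hψ
  set a := inChart α m with ha
  -- The flow in the chart, with time as a variable, so that commutation of `d` with pull-back
  -- replaces Cartan's formula.
  let Ψ : ℝ × R3 → R3 := fun x => ψ (Φ x.1 (ψ.symm x.2))
  let good : ℝ × R3 → Prop := fun x => x.1 ∈ Set.Ioo (-ε) ε ∧ x.2 ∈ ψ.target ∧
    ψ.symm x.2 ∈ U ∧ Φ x.1 (ψ.symm x.2) ∈ ψ.source
  have hgood : ∀ᶠ x in 𝓝 ((0 : ℝ), ψ m), good x := by
    have hz₀ : ψ m ∈ ψ.target := mem_extChartAt_target m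
    have hs : ContinuousAt (fun x : ℝ × R3 => ψ.symm x.2) ((0 : ℝ), ψ m) :=
      ContinuousAt.comp (f := Prod.snd) (contMDiffAt_extChartAt_symm hz₀).continuousAt
        continuousAt_snd
    have hm' : ψ.symm (ψ m) = m := ψ.left_inv (mem_extChartAt_source m)
    have h1 : ∀ᶠ x : ℝ × R3 in 𝓝 ((0 : ℝ), ψ m), x.1 ∈ Set.Ioo (-ε) ε :=
      continuousAt_fst.eventually (isOpen_Ioo.mem_nhds hΦ.zero_mem)
    have h2 : ∀ᶠ x : ℝ × R3 in 𝓝 ((0 : ℝ), ψ m), x.2 ∈ ψ.target :=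
      continuousAt_snd.eventually ((isOpen_extChartAt_target m).mem_nhds hz₀)
    have h3 : ∀ᶠ x : ℝ × R3 in 𝓝 ((0 : ℝ), ψ m), ψ.symm x.2 ∈ U :=
      hs.eventually (hΦ.isOpen.mem_nhds (by dsimp only; rwa [hm']))
    have h4 : ContinuousAt (fun x : ℝ × R3 => Φ x.1 (ψ.symm x.2)) ((0 : ℝ), ψ m) := by
      have h5 : ContinuousAt (fun x : ℝ × M => Φ x.1 x.2) ((0 : ℝ), ψ.symm (ψ m)) := by
        rw [hm']; exact (hΦ.contMDiffAt hΦ.zero_mem hm).continuousAt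
      exact ContinuousAt.comp (f := fun x : ℝ × R3 => (x.1, ψ.symm x.2)) h5
        (continuousAt_fst.prodMk hs)
    have h6 : ∀ᶠ x : ℝ × R3 in 𝓝 ((0 : ℝ), ψ m), Φ x.1 (ψ.symm x.2) ∈ ψ.source := by
      refine h4.eventually ((isOpen_extChartAt_source m).mem_nhds ?_)
      dsimp only
      rw [hm', hΦ.zero m hm]; exact mem_extChartAt_source m
    filter_upwards [h1, h2, h3, h6] with x a b c d using ⟨a, b, c, d⟩
  have hΨ : ∀ x, good x → ContDiffAt ℝ ∞ Ψ x ∧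
      fderiv ℝ Ψ x (1, 0) = dChart m (Φ x.1 (ψ.symm x.2)) (Y (Φ x.1 (ψ.symm x.2))) ∧
      ∀ w, fderiv ℝ Ψ x (0, w) = dChart m (Φ x.1 (ψ.symm x.2))
        (mfderiv (𝓡 3) (𝓡 3) (Φ x.1) (ψ.symm x.2) (dChartSymm m x.2 w)) := by
    rintro ⟨t, z⟩ ⟨ht, hz, hzU, hs⟩
    dsimp only at ht hz hzU hs ⊢
    have hout := contMDiffAt_extChartAt_of_mem hs
    have hin := contMDiffAt_extChartAt_symm hz
    have hsm : ContDiffAt ℝ ∞ Ψ (t, z) := by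
      have h1 : ContMDiffAt 𝓘(ℝ, ℝ × R3) (𝓘(ℝ, ℝ).prod (𝓡 3)) ∞
          (fun x : ℝ × R3 => (x.1, ψ.symm x.2)) (t, z) :=
        contDiffAt_fst.contMDiffAt.prodMk (hin.comp (t, z) contDiffAt_snd.contMDiffAt)
      have h2 : ContMDiffAt 𝓘(ℝ, ℝ × R3) (𝓡 3) ∞
          (fun x : ℝ × R3 => Φ x.1 (ψ.symm x.2)) (t, z) :=
        (hΦ.contMDiffAt ht hzU).comp (t, z) h1
      exact (ContMDiffAt.comp (t, z) hout h2).contDiffAt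
    have hd : HasFDerivAt Ψ (fderiv ℝ Ψ (t, z)) (t, z) :=
      (hsm.differentiableAt (by simp)).hasFDerivAt
    have houtd := (hout.mdifferentiableAt (by simp)).hasMFDerivAt
    refine ⟨hsm, ?_, fun w => ?_⟩
    · have h1 : HasFDerivAt (fun t => Ψ (t, z)) _ t :=
        HasFDerivAt.comp (g := Ψ) t hd (hasFDerivAt_prodMk_left t z)
      have h2 := houtd.comp t (hΦ.hasMFDerivAt_time ht hzU)
      have h3 := congrArg (fun L => L (1 : ℝ)) (hasMFDerivAt_unique h1.hasMFDerivAt h2)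
      refine Eq.trans h3 ?_
      change dChart m (Φ t (ψ.symm z)) ((1 : ℝ) • Y (Φ t (ψ.symm z))) = _
      rw [one_smul]
    · have h1 : HasFDerivAt (fun z => Ψ (t, z)) _ z :=
        HasFDerivAt.comp (g := Ψ) z hd (hasFDerivAt_prodMk_right t z)
      have h2 := houtd.comp z ((hΦ.hasMFDerivAt_space ht hzU).comp z
        (hin.mdifferentiableAt (by simp)).hasMFDerivAt)
      exact congrArg (fun L => L w) (hasMFDerivAt_unique h1.hasMFDerivAt h2)
  -- With `τ` for time, `Ψ^* a = dτ + a`: the first term is `α(Y) = 1`, the second is invariance.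
  -- The exterior derivative of the right side vanishes on `(∂_τ, w)`, while that of the left side
  -- at `τ = 0` is `da(Y, w)`.
  have hpull : ∀ x, good x → (a (Ψ x)).comp (fderiv ℝ Ψ x) =
      ContinuousLinearMap.fst ℝ ℝ R3 + (a x.2).comp (ContinuousLinearMap.snd ℝ ℝ R3) := by
    intro x hx
    obtain ⟨-, h1, h2⟩ := hΨ x hx
    obtain ⟨ht, hz, hzU, hs⟩ := hx
    ext
    · simp only [ContinuousLinearMap.comp_apply, ContinuousLinearMap.inl_apply, h1, a, Ψ]
      rw [inChart_dChart α hs, hαY]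
      simp
    · rename_i w
      simp only [ContinuousLinearMap.comp_apply, ContinuousLinearMap.inr_apply, h2, a, Ψ]
      rw [inChart_dChart α hs, hinv _ ht _ hzU]
      change inChart α m x.2 w = _
      simp
  have htend : Tendsto (fun z : R3 => ((0 : ℝ), z)) (𝓝 (ψ m)) (𝓝 ((0 : ℝ), ψ m)) :=
    (Continuous.prodMk_right (0 : ℝ)).tendsto (ψ m)
  filter_upwards [htend.eventually (eventually_eventually_nhds.2 hgood)] with z hz w
  have hgz := hz.self_of_nhds
  obtain ⟨h1, h2, h3⟩ := hΨ _ hgz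
  obtain ⟨ht, hzt, hzU, hs⟩ := hgz
  dsimp only at ht hzt hzU hs h2 h3
  have hΨz : Ψ (0, z) = z := by
    change ψ (Φ 0 (ψ.symm z)) = z
    rw [hΦ.zero _ hzU, ψ.right_inv hzt]
  have haz : DifferentiableAt ℝ a z :=
    (contDiffAt_inChart hα hzt Filter.univ_mem).differentiableAt (by simp)
  have h4 := dForm_pullback (a := a) (x := ((0 : ℝ), z)) (by rwa [hΨz])
    (h1.of_le ENat.LEInfty.out) (1, 0) (0, w)
  have h5 : fderiv ℝ Ψ (0, z) (0, w) = w := by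
    have h6 : (fun z => Ψ (0, z)) =ᶠ[𝓝 z] id := by
      filter_upwards [(Continuous.prodMk_right (0 : ℝ)).continuousAt.eventually hz] with y hy
      change ψ (Φ 0 (ψ.symm y)) = y
      rw [hΦ.zero _ hy.2.2.1, ψ.right_inv hy.2.1]
    have h7 : HasFDerivAt (fun z => Ψ (0, z)) _ z :=
      (h1.differentiableAt (by simp)).hasFDerivAt.comp z (hasFDerivAt_prodMk_right 0 z)
    exact congrArg (fun L => L w) (h7.unique ((hasFDerivAt_id z).congr_of_eventuallyEq h6))
  rw [h2, h5, hΨz, hΦ.zero _ hzU] at h4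
  rw [← h4, dForm_congr (hz.mono hpull)]
  have hsnd : ∀ x, fderiv ℝ (Prod.snd : ℝ × R3 → R3) x = ContinuousLinearMap.snd ℝ ℝ R3 :=
    fun x => hasFDerivAt_snd.fderiv
  have h8 := dForm_pullback (a := a) (f := Prod.snd) (x := ((0 : ℝ), z)) haz
    contDiffAt_snd (1, 0) (0, w)
  have h9 : DifferentiableAt ℝ (fun x : ℝ × R3 => (a x.2).comp (ContinuousLinearMap.snd ℝ ℝ R3))
      (0, z) := (DifferentiableAt.comp (𝕜 := ℝ) ((0 : ℝ), z) haz differentiableAt_snd).clm_comp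
        (differentiableAt_const _)
  rw [dForm_add (differentiableAt_const _) h9, dForm_const]
  simp only [hsnd] at h8
  rw [h8]
  simp [dForm]

/-- If `i_y da = 0` with `y ≠ 0`, then `da` vanishes on every plane that contains `y`. -/
theorem dForm_eq_zero_of_mem_ker {a : R3 → R3 →L[ℝ] ℝ} {z y : R3} (hy : y ≠ 0)
    (ha : ∀ w, dForm a z y w = 0) {g : R3 →L[ℝ] ℝ} (hg : g ≠ 0) (hgy : g y = 0) {v w : R3}
    (hv : g v = 0) (hw : g w = 0) : dForm a z v w = 0 := by
  by_contra hvw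
  -- Pairing a linear relation with `w` and `v` under `da` kills the coefficients of `v` and `w`,
  -- and then that of `y`. The three vectors thus span the space, although `g ≠ 0` vanishes on all
  -- of them.
  have hind : LinearIndependent ℝ ![y, v, w] := by
    rw [Fintype.linearIndependent_iff]
    intro c hc
    simp only [Fin.sum_univ_three, Matrix.cons_val] at hc
    have key : ∀ x, c 1 * dForm a z v x + c 2 * dForm a z w x = 0 := by
      intro x
      have h0 : dForm a z (c 0 • y + c 1 • v + c 2 • w) x = 0 := by rw [hc]; simp [dForm]
      simpa only [dForm_add_left, dForm_smul_left, ha, mul_zero, zero_add] using h0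
    have h1 : c 1 = 0 := by simpa [dForm_self, hvw] using key w
    have h2 : c 2 = 0 := by
      have := key v
      rw [dForm_swap a z w v, dForm_self] at this
      simpa [hvw] using this
    have h0 : c 0 = 0 := by simpa [h1, h2, hy] using hc
    intro i
    fin_cases i <;> assumption
  have hspan := hind.span_eq_top_of_card_eq_finrank (by simp)
  refine hg (ContinuousLinearMap.coe_injective (LinearMap.ext_on_range hspan fun i => ?_))
  fin_cases i <;> simp [hgy, hv, hw]

/-- Near every point, `γ = dF` and `α = dt + p dF`. -/
theorem exists_local_normal_form {Y : VField M} {U : Set M} {ε : ℝ} {Φ : ℝ → M → M}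
    (hΦ : IsLocalFlow Y U ε Φ) {α γ : OneForm M} (hα : SmoothOneFormOn α Set.univ)
    (hγ : IsClosedForm γ) (hαY : ∀ q, α q (Y q) = 1) (hγY : ∀ q, γ q (Y q) = 0)
    (hinv : ∀ t ∈ Set.Ioo (-ε) ε, ∀ q ∈ U, ∀ v : TangentSpace (𝓡 3) q,
      α (Φ t q) (mfderiv (𝓡 3) (𝓡 3) (Φ t) q v) = α q v) {m : M} (hm : m ∈ U) (hγm : γ m ≠ 0) :
    ∃ F t p : R3 → ℝ, ∀ᶠ z in 𝓝 (extChartAt (𝓡 3) m m),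
      ContDiffAt ℝ ∞ F z ∧ ContDiffAt ℝ ∞ t z ∧ ContDiffAt ℝ ∞ p z ∧
        fderiv ℝ F z = inChart γ m z ∧ inChart α m z = fderiv ℝ t z + p z • inChart γ m z := by
  have htgt : ∀ᶠ z in 𝓝 (extChartAt (𝓡 3) m m), z ∈ (extChartAt (𝓡 3) m).target :=
    extChartAt_target_mem_nhds m
  obtain ⟨F, hF⟩ := exists_local_primitive (g := inChart γ m)
    (htgt.mono fun z hz => contDiffAt_inChart hγ.smooth hz Filter.univ_mem)
    (htgt.mono fun z hz => dForm_inChart_of_closed hγ hz)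
  have hγ₀ : inChart γ m (extChartAt (𝓡 3) m m) ≠ 0 := by
    intro h
    refine hγm (ContinuousLinearMap.ext fun v => ?_)
    rw [← inChart_dChart γ (mem_extChartAt_source m) v, h]
    rfl
  have hg₀ : ∀ᶠ z in 𝓝 (extChartAt (𝓡 3) m m), inChart γ m z ≠ 0 :=
    (contDiffAt_inChart hγ.smooth (mem_extChartAt_target m)
      Filter.univ_mem).continuousAt.eventually_ne hγ₀
  obtain ⟨t, p, htp⟩ := exists_leafwise_normal_form (a := inChart α m) (F := F)
    (htgt.mono fun z hz => contDiffAt_inChart hα hz Filter.univ_mem) (hF.mono fun z hz => hz.1)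
    (by
      filter_upwards [htgt, hF, hg₀, eventually_dForm_field_eq_zero hΦ hα hαY hinv hm]
        with z hz hFz hgz hdz v w hv hw
      rw [hFz.2.fderiv] at hv hw
      refine dForm_eq_zero_of_mem_ker ?_ hdz hgz ?_ hv hw
      · intro h
        have h1 := inChart_dChart' α hz (Y ((extChartAt (𝓡 3) m).symm z))
        rw [h, map_zero, hαY] at h1
        exact zero_ne_one h1
      · exact (inChart_dChart' γ hz _).trans (hγY _))
    (by rwa [hF.self_of_nhds.2.fderiv])
  refine ⟨F, t, p, ?_⟩
  filter_upwards [hF, htp] with z hFz htpz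
  obtain ⟨h1, h2, h3⟩ := htpz
  rw [hFz.2.fderiv] at h3
  exact ⟨hFz.1, h1, h2, hFz.2.fderiv, h3⟩

/-- `d(dt + p dF) = dp ∧ dF`. -/
theorem dForm_normal_form {a g : R3 → R3 →L[ℝ] ℝ} {F t p : R3 → ℝ} {z₀ : R3}
    (h : ∀ᶠ z in 𝓝 z₀, ContDiffAt ℝ ∞ F z ∧ ContDiffAt ℝ ∞ t z ∧ ContDiffAt ℝ ∞ p z ∧
      fderiv ℝ F z = g z ∧ a z = fderiv ℝ t z + p z • g z) (v w : R3) :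
    dForm a z₀ v w = fderiv ℝ p z₀ v * g z₀ w - fderiv ℝ p z₀ w * g z₀ v := by
  obtain ⟨hF, ht, hp, hg, -⟩ := h.self_of_nhds
  have h1 : a =ᶠ[𝓝 z₀] fun z => fderiv ℝ t z + p z • fderiv ℝ F z := by
    filter_upwards [h] with z ⟨_, _, _, h4, h5⟩
    rw [h5, h4]
  have hdF : DifferentiableAt ℝ (fderiv ℝ F) z₀ :=
    (hF.fderiv_right (m := ∞) (by simp)).differentiableAt (by simp)
  have hdt : DifferentiableAt ℝ (fderiv ℝ t) z₀ :=
    (ht.fderiv_right (m := ∞) (by simp)).differentiableAt (by simp)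
  have hdp : DifferentiableAt ℝ p z₀ := hp.differentiableAt (by simp)
  rw [dForm_congr h1, dForm_add hdt (hdp.fun_smul hdF), dForm_smul hdp hdF,
    dForm_fderiv (hF.of_le ENat.LEInfty.out), dForm_fderiv (ht.of_le ENat.LEInfty.out), hg]
  ring

end LocalForm

/-! ### Contact forms on the manifold: normalization, rescaling, coordinates. -/

section ContactForms

open Filter

variable {M : Type*} [TopologicalSpace M] [ChartedSpace R3 M]

theorem kerField_apply (α : OneForm M) (q : M) (v : TangentSpace (𝓡 3) q) :
    v ∈ kerField α q ↔ α q v = 0 := Iff.rfl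

/-- A functional is determined by its kernel and its value on one transverse vector. -/
theorem apply_eq_mul_of_kerField_eq {α β : OneForm M} {q : M} (h : kerField β q = kerField α q)
    {y : TangentSpace (𝓡 3) q} (hy : α q y = 1) (v : TangentSpace (𝓡 3) q) :
    β q v = β q y * α q v := by
  have h1 : v - α q v • y ∈ kerField α q := by
    rw [kerField_apply, map_sub, map_smul, hy]; simp
  rw [← h, kerField_apply, map_sub, map_smul, sub_eq_zero, smul_eq_mul] at h1
  rw [h1, mul_comm]

/-- Composing a chart with a diffeomorphism of the model space yields a chart. -/
theorem trans_mem_maximalAtlas {c : OpenPartialHomeomorph M R3}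
    (hc : c ∈ IsManifold.maximalAtlas (𝓡 3) ∞ M) {e : OpenPartialHomeomorph R3 R3}
    (he : ContDiffOn ℝ ∞ e e.source) (he' : ContDiffOn ℝ ∞ e.symm e.target) :
    c ≫ₕ e ∈ IsManifold.maximalAtlas (𝓡 3) ∞ M := by
  have heG : e ∈ contDiffGroupoid ∞ (𝓡 3) := by
    rw [contDiffGroupoid, mem_groupoid_of_pregroupoid]
    simpa [contDiffPregroupoid] using And.intro he he'
  intro e₁ he₁
  obtain ⟨h1, h2⟩ := mem_maximalAtlas_iff.1 hc e₁ he₁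
  constructor
  · rw [OpenPartialHomeomorph.trans_symm_eq_symm_trans_symm, OpenPartialHomeomorph.trans_assoc]
    exact StructureGroupoid.trans _ (StructureGroupoid.symm _ heG) h1
  · rw [← OpenPartialHomeomorph.trans_assoc]
    exact StructureGroupoid.trans _ h2 heG

variable [IsManifold (𝓡 3) ∞ M]

theorem contMDiffAt_form_apply {α : OneForm M} {Y : VField M} {U : Set M} {q : M} (hU : U ∈ 𝓝 q)
    (hα : SmoothOneFormOn α U) (hY : SmoothVFieldOn Y U) :
    ContMDiffAt (𝓡 3) 𝓘(ℝ, ℝ) ∞ (fun q => α q (Y q)) q := by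
  have := isManifold_one (M := M)
  have h := ContMDiffAt.clm_bundle_apply (F₁ := R3) (E₁ := fun q : M => TangentSpace (𝓡 3) q)
    (F₂ := ℝ) (E₂ := Bundle.Trivial M ℝ) (b := fun q : M => q) (hα.contMDiffAt hU)
    (hY.contMDiffAt hU)
  exact (contMDiffAt_totalSpace.1 h).2

theorem SmoothOneFormOn.add {α β : OneForm M} {U : Set M} (hα : SmoothOneFormOn α U)
    (hβ : SmoothOneFormOn β U) : SmoothOneFormOn (fun q => α q + β q) U :=
  ContMDiffOn.add_section hα hβ

/-- The contact form with `α(Y) = 1`. -/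
theorem exists_normalized_contactForm {ξ : Distribution M} (hξ : IsContactStructure ξ)
    {Y : VField M} (hY : SmoothVFieldOn Y Set.univ) (hYξ : ∀ q, Y q ∉ ξ q) :
    ∃ α : OneForm M, SmoothOneFormOn α Set.univ ∧ kerField α = ξ ∧ ∀ q, α q (Y q) = 1 := by
  choose U hU β hβ using hξ
  have hne : ∀ m, ∀ q ∈ U m, β m q (Y q) ≠ 0 := fun m q hq h => by
    refine hYξ q ?_
    rw [← (hβ m).ker_eq q hq]
    exact h
  let α : OneForm M := fun q => (β q q (Y q))⁻¹ • β q q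
  have hαY : ∀ q, α q (Y q) = 1 := fun q => inv_mul_cancel₀ (hne q q (hU q))
  have hker : kerField α = ξ := by
    funext q
    rw [← (hβ q).ker_eq q (hU q)]
    ext v
    change (β q q (Y q))⁻¹ * β q q v = 0 ↔ β q q v = 0
    simp [hne q q (hU q)]
  refine ⟨α, fun m _ => ContMDiffAt.contMDiffWithinAt ?_, hker, hαY⟩
  have hUm : U m ∈ 𝓝 m := (hβ m).isOpen.mem_nhds (hU m)
  have hf := contMDiffAt_form_apply hUm (hβ m).smooth (hY.mono (Set.subset_univ _))
  have hf' : ContMDiffAt (𝓡 3) 𝓘(ℝ, ℝ) ∞ (fun q => (β m q (Y q))⁻¹) m :=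
    hf.inv₀ (hne m m (hU m))
  refine (hf'.smul_section ((hβ m).smooth.contMDiffAt hUm)).congr_of_eventuallyEq ?_
  filter_upwards [hUm] with q hq
  -- The form `α` was built from a different local form at each point. Kernel and value on `Y`
  -- determine it, so near `m` it is the normalization of the single smooth form `β m`.
  have h1 : α q = (β m q (Y q))⁻¹ • β m q := by
    ext v
    have h2 := apply_eq_mul_of_kerField_eq (α := α) (β := β m) (q := q)
      (by rw [(hβ m).ker_eq q hq, hker]) (hαY q) v
    change α q v = (β m q (Y q))⁻¹ * β m q v
    rw [h2, inv_mul_cancel_left₀ (hne m q hq)]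
  simp only [h1]
  rfl

theorem dChart_self (m : M) (v : TangentSpace (𝓡 3) m) : dChart m m v = v := by
  have := isManifold_one (M := M)
  exact congrArg (fun L => L v) (mfderiv_extChartAt_self (I := 𝓡 3) (x := m))

theorem inChart_self (α : OneForm M) (m : M) (v : TangentSpace (𝓡 3) m) :
    inChart α m (extChartAt (𝓡 3) m m) v = α m v := by
  rw [← inChart_dChart α (mem_extChartAt_source m) v, dChart_self]

theorem contDiffAt_inChart_self {α : OneForm M} {U : Set M} {m : M} (hα : SmoothOneFormOn α U)
    (hU : U ∈ 𝓝 m) : ContDiffAt ℝ ∞ (inChart α m) (extChartAt (𝓡 3) m m) :=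
  contDiffAt_inChart hα (mem_extChartAt_target m)
    (by rwa [(extChartAt (𝓡 3) m).left_inv (mem_extChartAt_source m)])

theorem extD_add_closed {α γ : OneForm M} (hα : SmoothOneFormOn α Set.univ) (hγ : IsClosedForm γ)
    (m : M) (v w : TangentSpace (𝓡 3) m) :
    extD (fun q => α q + γ q) m v w = extD α m v w := by
  have hd := dForm_add
    ((contDiffAt_inChart_self (m := m) hα Filter.univ_mem).differentiableAt (by simp))
    ((contDiffAt_inChart_self (m := m) hγ.smooth Filter.univ_mem).differentiableAt (by simp)) v w
  have h0 : dForm (inChart γ m) (extChartAt (𝓡 3) m m) v w = 0 := hγ.closed m v w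
  rw [h0, add_zero] at hd
  exact hd

/-- The exterior derivative of a form that reads `dt + p dF` in the chart at `m`. -/
theorem extD_eq_of_normal_form {α γ : OneForm M} {m : M} {F t p : R3 → ℝ}
    (h : ∀ᶠ z in 𝓝 (extChartAt (𝓡 3) m m), ContDiffAt ℝ ∞ F z ∧ ContDiffAt ℝ ∞ t z ∧
      ContDiffAt ℝ ∞ p z ∧ fderiv ℝ F z = inChart γ m z ∧
      inChart α m z = fderiv ℝ t z + p z • inChart γ m z) :
    ∃ dp : TangentSpace (𝓡 3) m →L[ℝ] ℝ, dp = fderiv ℝ p (extChartAt (𝓡 3) m m) ∧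
      ∀ v w, extD α m v w = dp v * γ m w - dp w * γ m v := by
  refine ⟨fderiv ℝ p (extChartAt (𝓡 3) m m), rfl, fun v w => ?_⟩
  rw [← inChart_self γ, ← inChart_self γ]
  exact dForm_normal_form h v w

/-- `β ∧ dβ = f² α ∧ dα` for `β = f α`. -/
theorem IsContactFormOn.wedgeD_eq {α β : OneForm M} {U : Set M} {Y : VField M}
    (hβ : IsContactFormOn (kerField α) β U) (hα : SmoothOneFormOn α Set.univ)
    (hY : SmoothVFieldOn Y Set.univ) (hαY : ∀ q, α q (Y q) = 1) {q : M} (hq : q ∈ U)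
    (u v w : TangentSpace (𝓡 3) q) :
    wedgeD β β q u v w = β q (Y q) ^ 2 * wedgeD α α q u v w := by
  have hUq : U ∈ 𝓝 q := hβ.isOpen.mem_nhds hq
  have hmul : ∀ q' ∈ U, ∀ v, β q' v = β q' (Y q') * α q' v := fun q' hq' v =>
    apply_eq_mul_of_kerField_eq (hβ.ker_eq q' hq') (hαY q') v
  have hf := contMDiffAt_form_apply hUq hβ.smooth (hY.mono (Set.subset_univ _))
  have hq₀ : (extChartAt (𝓡 3) q).symm (extChartAt (𝓡 3) q q) = q :=
    (extChartAt (𝓡 3) q).left_inv (mem_extChartAt_source q)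
  let f : R3 → ℝ := fun z => β ((extChartAt (𝓡 3) q).symm z) (Y ((extChartAt (𝓡 3) q).symm z))
  have hfd : DifferentiableAt ℝ f (extChartAt (𝓡 3) q q) :=
    (contDiffAt_comp_extChartAt_symm (f := fun q => β q (Y q)) (mem_extChartAt_target q)
      (by rw [hq₀]; exact hf)).differentiableAt (by simp)
  have hf₀ : f (extChartAt (𝓡 3) q q) = β q (Y q) := by simp only [f]; rw [hq₀]
  have had := (contDiffAt_inChart_self (m := q) hα Filter.univ_mem).differentiableAt (by simp)
  have hev : inChart β q =ᶠ[𝓝 (extChartAt (𝓡 3) q q)] fun z => f z • inChart α q z := by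
    have h1 : ContinuousAt (extChartAt (𝓡 3) q).symm (extChartAt (𝓡 3) q q) :=
      continuousAt_extChartAt_symm q
    filter_upwards [h1.eventually (by rw [hq₀]; exact hUq)] with z hz
    ext v
    exact hmul _ hz _
  have hext : ∀ v w, extD β q v w = β q (Y q) * extD α q v w +
      (fderiv ℝ f (extChartAt (𝓡 3) q q) v * α q w -
        fderiv ℝ f (extChartAt (𝓡 3) q q) w * α q v) := by
    intro v w
    have h1 := (dForm_congr hev v w).trans (dForm_smul hfd had v w)
    rw [hf₀] at h1
    rw [← inChart_self α, ← inChart_self α]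
    exact h1
  -- The terms with `df` cancel, since they assemble to `f α ∧ df ∧ α = 0`.
  simp only [wedgeD, hext, hmul q hq u, hmul q hq v, hmul q hq w]
  ring

theorem IsContactFormOn.apply_field_ne_zero {α β : OneForm M} {U : Set M} {Y : VField M}
    (hβ : IsContactFormOn (kerField α) β U) (hαY : ∀ q, α q (Y q) = 1) {q : M} (hq : q ∈ U) :
    β q (Y q) ≠ 0 := by
  intro h
  have h1 : Y q ∈ kerField α q := by rw [← hβ.ker_eq q hq]; exact h
  rw [kerField_apply, hαY] at h1
  exact one_ne_zero h1

/-- A pair of the form `ker (dt + p dF)`, `ker (dt + (p + 1) dF)` is of type I₂ with `c = 2`. -/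
theorem isTypeI2At_of_normal_form {α γ : OneForm M} {m : M} {F t p : R3 → ℝ}
    (h : ∀ᶠ z in 𝓝 (extChartAt (𝓡 3) m m), ContDiffAt ℝ ∞ F z ∧ ContDiffAt ℝ ∞ t z ∧
      ContDiffAt ℝ ∞ p z ∧ fderiv ℝ F z = inChart γ m z ∧
      inChart α m z = fderiv ℝ t z + p z • inChart γ m z)
    (hnd : ∃ u v w : TangentSpace (𝓡 3) m, wedgeD α α m u v w ≠ 0) :
    IsTypeI2At (kerField α) (kerField fun q => α q + γ q) 2 m := by
  obtain ⟨e, hz₀, heS, he₀, hes, hei, heq⟩ := exists_typeI2_coordinates h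
    (by
      obtain ⟨u, v, w, huvw⟩ := hnd
      refine ⟨u, v, w, ?_⟩
      obtain ⟨dp, hdp, hext⟩ := extD_eq_of_normal_form h
      simp only [wedgeD, hext] at huvw
      rw [← inChart_self α, ← inChart_self α, ← inChart_self α, ← inChart_self γ,
        ← inChart_self γ, ← inChart_self γ, hdp] at huvw
      exact huvw)
    (extChartAt_target_mem_nhds m)
  have hcoe : ∀ q, (chartAt R3 m ≫ₕ e) q = e (extChartAt (𝓡 3) m q) := fun q => rfl
  refine ⟨chartAt R3 m ≫ₕ e, trans_mem_maximalAtlas (IsManifold.chart_mem_maximalAtlas m) hes hei,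
    ⟨mem_chart_source R3 m, hz₀⟩, he₀, fun q hq v => ?_⟩
  have hqs : q ∈ (extChartAt (𝓡 3) m).source := by rw [extChartAt_source]; exact hq.1
  have hqe : extChartAt (𝓡 3) m q ∈ e.source := hq.2
  have hd : ∀ i : Fin 3, mfderiv (𝓡 3) 𝓘(ℝ, ℝ) (fun q => (chartAt R3 m ≫ₕ e) q i) q v =
      fderiv ℝ (fun z => e z i) (extChartAt (𝓡 3) m q) (dChart m q v) := by
    intro i
    have h1 : DifferentiableAt ℝ e (extChartAt (𝓡 3) m q) :=
      (hes.contDiffAt (e.open_source.mem_nhds hqe)).differentiableAt (by simp)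
    have h2 : DifferentiableAt ℝ (fun z => e z i) (extChartAt (𝓡 3) m q) :=
      (EuclideanSpace.proj i : R3 →L[ℝ] ℝ).differentiableAt.comp _ h1
    have h3 := h2.hasFDerivAt.hasMFDerivAt.comp q
      ((contMDiffAt_extChartAt_of_mem hqs).mdifferentiableAt (by simp)).hasMFDerivAt
    exact congrArg (fun L => L v) h3.mfderiv
  obtain ⟨h1, h2⟩ := heq _ hqe (dChart m q v)
  rw [inChart_dChart α hqs] at h1 h2
  rw [inChart_dChart γ hqs] at h2
  dsimp only
  rw [hd 0, hd 1, hcoe]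
  exact ⟨h1, h2⟩

end ContactForms

/-! ### Nonvanishing of `γ`, invariance of kernels, the Reeb condition. -/

section Main

open Filter

variable {M : Type*} [TopologicalSpace M] [ChartedSpace R3 M] [IsManifold (𝓡 3) ∞ M]

/-- A form whose kernel is spanned by two vectors does not vanish. -/
theorem ne_zero_of_line_sup_span {γ : OneForm M} {L : Distribution M} (hL : IsLineField L)
    {q : M} {y : TangentSpace (𝓡 3) q} (h : L q ⊔ Submodule.span ℝ {y} = kerField γ q) :
    γ q ≠ 0 := by
  intro h0
  obtain ⟨U, -, hq, Z, -, hZ⟩ := hL q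
  obtain ⟨-, hLq⟩ := hZ q hq
  have htop : kerField γ q = ⊤ := by
    ext v; simp [kerField_apply, h0]
  rw [hLq, htop, ← Submodule.span_union, Set.singleton_union] at h
  have h1 : Module.finrank ℝ (Submodule.span ℝ (({Z q, y} : Set R3))) ≤ 2 := by
    let x₁ : R3 := Z q
    let x₂ : R3 := y
    have := finrank_span_finset_le_card (R := ℝ) ({x₁, x₂} : Finset R3)
    rw [Finset.coe_pair] at this
    exact this.trans Finset.card_le_two
  have h2 : Submodule.span ℝ (({Z q, y} : Set R3)) = ⊤ := h
  rw [h2, finrank_top, finrank_euclideanSpace_fin] at h1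
  omega

/-- If each local flow of `Y` preserves `α` and `α(Y) = 1`, and the flow of `Y` preserves some
complement `ker β` of `Y`, then the flow preserves `ker α`. -/
theorem FlowPreserves.of_pullback [T2Space M] {Y : VField M} (hY : SmoothVFieldOn Y Set.univ)
    {α β : OneForm M} (hβ : FlowPreserves Y (kerField β)) (hβY : ∀ q, β q (Y q) = 1)
    (hα : ∀ U ε Φ, IsLocalFlow Y U ε Φ → ∀ t ∈ Set.Ioo (-ε) ε, ∀ q ∈ U,
      ∀ v : TangentSpace (𝓡 3) q, α (Φ t q) (mfderiv (𝓡 3) (𝓡 3) (Φ t) q v) = α q v) :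
    FlowPreserves Y (kerField α) := by
  refine ⟨hβ.1, fun U ε Φ hΦ t ht q hq => le_antisymm ?_ ?_⟩
  · rintro _ ⟨v, hv, rfl⟩
    exact (hα U ε Φ hΦ t ht q hq v).trans hv
  -- The reverse inclusion needs surjectivity of the derivative of the flow: the `ker β` part of `w`
  -- has a preimage by hypothesis, and `Y` is the image of `Y`. Invariance of `α` then puts the
  -- preimage in `ker α`.
  · intro w hw
    have h1 : w - β (Φ t q) w • Y (Φ t q) ∈ kerField β (Φ t q) := by
      rw [kerField_apply, map_sub, map_smul, hβY]; simp
    rw [← hβ.2 U ε Φ hΦ t ht q hq] at h1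
    obtain ⟨v', -, hv'⟩ := h1
    have h2 : mfderiv (𝓡 3) (𝓡 3) (Φ t) q (v' + β (Φ t q) w • Y q) = w := by
      rw [map_add, map_smul, hΦ.mfderiv_apply_field hY ht hq]
      have h3 : mfderiv (𝓡 3) (𝓡 3) (Φ t) q v' = w - β (Φ t q) w • Y (Φ t q) := hv'
      rw [h3, sub_add_cancel]
    refine ⟨_, ?_, h2⟩
    change α q _ = 0
    rw [← hα U ε Φ hΦ t ht q hq, h2]
    exact hw

/-- A Reeb field of `ker α` with `α(Y) = 1` satisfies `i_Y dα = 0`. -/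
theorem extD_field_eq_zero {Y : VField M} {U : Set M} {ε : ℝ} {Φ : ℝ → M → M}
    (hΦ : IsLocalFlow Y U ε Φ) {α : OneForm M} (hα : SmoothOneFormOn α Set.univ)
    (hαY : ∀ q, α q (Y q) = 1)
    (hinv : ∀ t ∈ Set.Ioo (-ε) ε, ∀ q ∈ U, ∀ v : TangentSpace (𝓡 3) q,
      α (Φ t q) (mfderiv (𝓡 3) (𝓡 3) (Φ t) q v) = α q v) {m : M} (hm : m ∈ U)
    (v : TangentSpace (𝓡 3) m) : extD α m (Y m) v = 0 := by
  have h := (eventually_dForm_field_eq_zero hΦ hα hαY hinv hm).self_of_nhds v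
  rw [(extChartAt (𝓡 3) m).left_inv (mem_extChartAt_source m), dChart_self] at h
  exact h

end Main

end ContactPair

end

/-! ### The pair `ker α`, `ker (α + γ)`. -/

theorem mainTheorem3 {M : Type*} [TopologicalSpace M] [T2Space M]
    [ChartedSpace ContactPair.R3 M] [IsManifold (𝓡 3) ∞ M]
    (ξ : ContactPair.Distribution M) (hξ : ContactPair.IsContactStructure ξ)
    (Y : ContactPair.VField M) (L : ContactPair.Distribution M)
    (hY : ContactPair.IsContactIntegrable ξ Y L)
    (γ : ContactPair.OneForm M) (hγ : ContactPair.IsClosedForm γ)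
    (hker : ∀ q, L q ⊔ Submodule.span ℝ {Y q} = ContactPair.kerField γ q) :
    ∃ α : ContactPair.OneForm M,
      (ContactPair.IsContactFormOn ξ α Set.univ ∧ (∀ q, α q (Y q) = 1) ∧
        (∀ q v, ContactPair.extD α q (Y q) v = 0)) ∧
      ∃ ξ' : ContactPair.Distribution M,
        ξ' = ContactPair.kerField (fun q => α q + γ q) ∧
        ContactPair.IsContactStructure ξ' ∧
        ContactPair.Transverse ξ ξ' ∧
        ContactPair.CommonlyOriented ξ ξ' ∧
        ContactPair.FlowPreserves Y ξ' ∧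
        (∃ X : ContactPair.VField M,
          ContactPair.IsGeneratingInvariant ξ ξ' X (fun _ => 2)) ∧
        ∀ m, ContactPair.IsTypeI2At ξ ξ' 2 m := by
  open ContactPair in
  have hYs := hY.reeb.smooth
  obtain ⟨α, hα, rfl, hαY⟩ := exists_normalized_contactForm hξ hYs hY.reeb.transverse
  have hγY : ∀ q, γ q (Y q) = 0 := fun q => by
    have h : Y q ∈ kerField γ q := by
      rw [← hker q]
      exact Submodule.mem_sup_right (Submodule.mem_span_singleton_self _)
    exact h
  have hγ0 : ∀ q, γ q ≠ 0 := fun q => ne_zero_of_line_sup_span hY.lineField (hker q)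
  have hinv : ∀ U ε Φ, IsLocalFlow Y U ε Φ → ∀ t ∈ Set.Ioo (-ε) ε, ∀ q ∈ U,
      ∀ v : TangentSpace (𝓡 3) q, α (Φ t q) (mfderiv (𝓡 3) (𝓡 3) (Φ t) q v) = α q v :=
    fun U ε Φ hΦ t ht q hq v => hΦ.pullback_of_preserves hYs hY.reeb.preserves hαY ht hq v
  let α' : OneForm M := fun q => α q + γ q
  have hα' : SmoothOneFormOn α' Set.univ := hα.add hγ.smooth
  have hα'Y : ∀ q, α' q (Y q) = 1 := fun q => by
    change α q (Y q) + γ q (Y q) = 1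
    rw [hαY, hγY, add_zero]
  have hα'_apply : ∀ q v, α' q v = α q v + γ q v := fun q v => rfl
  have hext' : ∀ q v w, extD α' q v w = extD α q v w := extD_add_closed hα hγ
  have hnf : ∀ m, ∃ F t p : R3 → ℝ, ∀ᶠ z in 𝓝 (extChartAt (𝓡 3) m m),
      ContDiffAt ℝ ∞ F z ∧ ContDiffAt ℝ ∞ t z ∧ ContDiffAt ℝ ∞ p z ∧
        fderiv ℝ F z = inChart γ m z ∧ inChart α m z = fderiv ℝ t z + p z • inChart γ m z := by
    intro m
    obtain ⟨U, ε, Φ, hm, hΦ⟩ := hY.reeb.preserves.1 m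
    exact exists_local_normal_form hΦ hα hγ hαY hγY (hinv U ε Φ hΦ) hm (hγ0 m)
  have hext : ∀ m, ∃ dp : TangentSpace (𝓡 3) m →L[ℝ] ℝ,
      ∀ v w, extD α m v w = dp v * γ m w - dp w * γ m v := by
    intro m
    obtain ⟨F, t, p, h⟩ := hnf m
    obtain ⟨dp, -, hdp⟩ := extD_eq_of_normal_form h
    exact ⟨dp, hdp⟩
  have hnd : ∀ q, ∃ u v w : TangentSpace (𝓡 3) q, wedgeD α α q u v w ≠ 0 := by
    intro q
    obtain ⟨U, hq, β, hβ⟩ := hξ q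
    obtain ⟨u, v, w, h⟩ := hβ.nondegenerate q hq
    refine ⟨u, v, w, fun h0 => h ?_⟩
    rw [hβ.wedgeD_eq hα hYs hαY hq, h0, mul_zero]
  -- This is `γ ∧ dα = γ ∧ dp ∧ γ = 0` together with `dα' = dα`.
  have hvol : ∀ q u v w, wedgeD α α q u v w = wedgeD α' α' q u v w := by
    intro q u v w
    obtain ⟨dp, hdp⟩ := hext q
    simp only [wedgeD, hext', hdp, hα'_apply]
    ring
  have hcf : IsContactFormOn (kerField α) α Set.univ :=
    ⟨isOpen_univ, hα, fun _ _ => rfl, fun q _ => hnd q⟩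
  have hcf' : IsContactFormOn (kerField α') α' Set.univ :=
    ⟨isOpen_univ, hα', fun _ _ => rfl, fun q _ => by simpa only [← hvol] using hnd q⟩
  have hdual : ∀ q, ∀ dp : TangentSpace (𝓡 3) q →L[ℝ] ℝ,
      (∀ v w, extD α q v w = dp v * γ q w - dp w * γ q v) → ∀ r s t,
      ∃ x, α q x = r ∧ dp x = s ∧ γ q x = t := by
    intro q dp hdp r s t
    obtain ⟨u, v, w, h⟩ := hnd q
    simp only [wedgeD, hdp] at h
    exact exists_forall_eq_of_det_ne_zero (α q).toLinearMap dp.toLinearMap (γ q).toLinearMap h r s t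
  refine ⟨α, ⟨hcf, hαY, fun q v => ?_⟩, kerField α', rfl, fun m => ⟨Set.univ, trivial, α', hcf'⟩,
    fun q => ?_, ?_, ?_, ?_, fun m => ?_⟩
  · obtain ⟨U, ε, Φ, hm, hΦ⟩ := hY.reeb.preserves.1 q
    exact extD_field_eq_zero hΦ hα hαY (hinv U ε Φ hΦ) hm v
  · obtain ⟨dp, hdp⟩ := hext q
    -- A vector of `ker α` with `α'(x) = 1` splits any `v` as `α'(v) x` plus an element of `ker α'`.
    obtain ⟨x, hx1, -, hx3⟩ := hdual q dp hdp 0 0 1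
    refine eq_top_iff.2 fun v _ => ?_
    have h1 : α' q v • x ∈ kerField α q := by
      rw [kerField_apply, map_smul, hx1, smul_zero]
    have h2 : v - α' q v • x ∈ kerField α' q := by
      rw [kerField_apply, map_sub, map_smul, hα'_apply q x, hx1, hx3]; simp
    have h3 := Submodule.add_mem_sup h1 h2
    rwa [add_sub_cancel] at h3
  · intro U β β' hβ hβ' q hq
    have h1 := hβ.apply_field_ne_zero hαY hq
    have h2 := hβ'.apply_field_ne_zero hα'Y hq
    refine ⟨β q (Y q) ^ 2 / β' q (Y q) ^ 2, by positivity, fun u v w => ?_⟩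
    rw [hβ.wedgeD_eq hα hYs hαY hq, hβ'.wedgeD_eq hα' hYs hα'Y hq, hvol]
    field_simp
  · refine FlowPreserves.of_pullback hYs hY.reeb.preserves hαY fun U ε Φ hΦ t ht q hq v => ?_
    rw [hα'_apply, hα'_apply, hinv U ε Φ hΦ t ht q hq, hΦ.pullback_closed hγ hγY ht hq]
  · choose dp hdp using hext
    -- The value `dp(X) = -1` orients the axis: it gives `i_X dα = -γ`, hence `i_X (α ∧ dα) = α ∧ γ
    -- = α ∧ α'`.
    choose X hX1 hX2 hX3 using fun q => hdual q (dp q) (hdp q) 0 (-1) 0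
    refine ⟨X, fun m => ⟨Set.univ, α, α', trivial, hcf, hcf', fun q _ =>
      ⟨⟨hX1 q, ?_⟩, hvol q, fun v w => ?_, fun u v w => ?_⟩⟩⟩
    · change α q (X q) + γ q (X q) = 0
      rw [hX1, hX3, add_zero]
    · simp only [wedgeD, wedge, hdp, hα'_apply, hX1, hX2, hX3]
      ring
    · simp only [wedgeD, hext', hdp, hα'_apply]
      ring
  · obtain ⟨F, t, p, h⟩ := hnf m
    exact isTypeI2At_of_normal_form h (hnd m)
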